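/- **Setting.** Let $M,m\ge 1$ and $f_1,\dots,f_M:\mathbb R^d\times\mathbb R^m\to\mathbb R$ be differentiable, $f=\frac1M\sum_i f_i$, and let $L,\mu>0$, $\kappa=L/\mu$. Assume that every $f_i(x,\cdot)$ is $\mu$-strongly concave and that $\Phi(x)=\max_y f(x,y)$ is bounded below; write $y^*(x)=\arg\max_y f(x,y)$. Agent $i$ has a stochastic oracle $\tilde\nabla f_i(z;\xi)$ such that, for $\xi$ with the sampling law of agent $i$ and all $z,z'$, $\mathbf E\,\tilde\nabla f_i(z;\xi)=\nabla f_i(z)$, $\mathbf E\|\tilde\nabla f_i(z;\xi)-\nabla f_i(z)\|^2\le\sigma^2$ and $\mathbf E\|\tilde\nabla f_i(z;\xi)-\tilde\nabla f_i(z';\xi)\|^2\le L^2\|z-z'\|^2$. Let $W\in\mathbb R^{M\times M}$ be a matrix with non-negative entries, with $w_{ij}=0$ when $(i,j)$ is not an edge of the connected network, with $W\mathbf 1=\mathbf 1$, $W^\top\mathbf 1=\mathbf 1$, and with $\rho=\|W-\frac1M\mathbf 1\mathbf 1^\top\|_2<1$. **Algorithm (DGDA-VR).** The rows of the matrices $Z^t=(X^t,Y^t)$,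 $V^t$, $D^t$ belong to the agents; for a batch $\mathcal B$ of agent $i$, $G_i^t(\mathcal B)$ is the average over $\xi\in\mathcal B$ of $\tilde\nabla f_i(z_i^t;\xi)$. Given a deterministic $Z^0$, the initial estimators are $v_i^0=G_i^0(\mathcal C_i^0)$ with $|\mathcal C_i^0|=S_1$, and $D^0$ is any square-integrable measurable function of the initial samples whose row average equals that of $V^0$ (for example $D^0=V^0$). For $t\ge0$, $$X^{t+1}=WX^t-\eta_xD_x^t,\qquad Y^{t+1}=WY^t+\eta_yD_y^t,\qquad D^{t+1}=W(D^t+V^{t+1}-V^t),$$ where $v_i^{t+1}=G_i^{t+1}(\mathcal C_i^{t+1})$ with $|\mathcal C_i^{t+1}|=S_1$ if $q$ divides $t+r$, and $v_i^{t+1}=G_i^{t+1}(\mathcal B_i^{t+1})-G_i^{t}(\mathcal B_i^{t+1})+v_i^t$ with $|\mathcal B_i^{t+1}|=S_2$ otherwise. The phase $r\in\{0,1\}$ is fixed. The samples in a batch are independent, and the batches of different times are independent. **Parameters.** $\eta_x,\eta_y>0$, and $q,S_1,S_2$ are positive integers, such that $$\eta_y\le\frac{1}{32\sqrt5\,L}\min\Big\{(1-\rho)^2,\frac1\kappa,\frac{1-\rho}{\sqrt\kappa}\Big\},\qquad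 \eta_x\le\min\Big\{\frac1{6(\kappa+1)L},\frac{\eta_y}{8\sqrt3\,\kappa^2},\frac{4\eta_y}{5\mu},\frac{\eta_y}{64\kappa^2}\Big\},\qquad S_2\ge q\ge1,$$ and $\eta_y\le\frac{(1-\rho)^2}{32\sqrt5}$ (the last bound is automatic if $L\ge1$). **Theorem.** $\Phi$ is differentiable, for every $t$ the random variables $\|\nabla\Phi(\bar x^t)\|^2$ and $\Phi(\bar x^t)$ are integrable, and for every $T=Nq$ with an integer $N\ge1$, $$\frac1T\sum_{j=0}^{T-1}\mathbf E\|\nabla\Phi(\bar x^j)\|^2\le\frac1T\Big(\frac{50}{\eta_x}\mathbf E\big[\Phi(\bar x^0)-\Phi(\bar x^T)\big]+\frac{900L\kappa}{\eta_y}\delta_0+\frac{50\cdot9772\,L^2\kappa^2}{(1-\rho)M}\Lambda_0\Big)+\frac{50\cdot323\,\kappa^2\sigma^2}{S_1},$$ where $\bar x^t,\bar y^t$ are the averages of the rows of $X^t,Y^t$, $\delta_0=\|y^*(\bar x^0)-\bar y^0\|^2$, and $\Lambda_0=\sum_i\|z_i^0-\bar z^0\|^2+\mathbf E\sum_i\|d_i^0-\bar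 d^0\|^2$, with $\bar z^0,\bar d^0$ the averages of the rows of $Z^0$ and $D^0$. -/

import Mathlib

open MeasureTheory ProbabilityTheory

namespace DGDA

noncomputable section

/-! ### The minimax problem -/

/-- The Euclidean space of pairs `(x, y)`, with the norm `√(‖x‖² + ‖y‖²)`. -/
abbrev Pt (d m : ℕ) : Type :=
  WithLp 2 (EuclideanSpace ℝ (Fin d) × EuclideanSpace ℝ (Fin m))

/-- The pair `(x, y)` as a point of the Euclidean space `Pt d m`. -/
def pt {d m : ℕ} (x : EuclideanSpace ℝ (Fin d)) (y : EuclideanSpace ℝ (Fin m)) : Pt d m :=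
  WithLp.toLp 2 (x, y)

/-- The average of the vectors held by the `M` agents. -/
def avg {M : ℕ} {E : Type*} [AddCommGroup E] [Module ℝ E] (u : Fin M → E) : E :=
  (1 / (M : ℝ)) • ∑ i, u i

/-- The squared consensus error `‖U - Ū‖_F² = ∑ i, ‖u_i - ū‖²`, the rows of `U` being the `u_i`. -/
def consensusErr {M d m : ℕ} (u : Fin M → Pt d m) : ℝ :=
  ∑ i, ‖u i - avg u‖ ^ 2

/-- The global objective `f(x, y) = (1/M) ∑ i, f_i(x, y)`. -/
def objective {M d m : ℕ} (f : Fin M → Pt d m → ℝ)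
    (x : EuclideanSpace ℝ (Fin d)) (y : EuclideanSpace ℝ (Fin m)) : ℝ :=
  (1 / (M : ℝ)) * ∑ i, f i (pt x y)

/-- The primal function `Φ(x) = max_y f(x, y)`. -/
def primal {M d m : ℕ} (f : Fin M → Pt d m → ℝ) (x : EuclideanSpace ℝ (Fin d)) : ℝ :=
  ⨆ y, objective f x y

/-- The best response `y*(x) = argmax_y f(x, y)`; the maximiser exists and is unique whenever
every `f_i(x, ·)` is strongly concave and there is at least one agent. -/
def bestResponse {M d m : ℕ} (f : Fin M → Pt d m → ℝ) (x : EuclideanSpace ℝ (Fin d)) :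
    EuclideanSpace ℝ (Fin m) :=
  Classical.epsilon fun y => IsMaxOn (objective f x) Set.univ y

/-! ### The stochastic oracles -/

/-- `g i z s` is the stochastic gradient of `f_i` at `z` for the sample `s`, and `P i` is the law of
the samples of agent `i`: the oracle is unbiased, its variance is at most `σ²`, and it is
mean-squared `L`-Lipschitz. -/
structure IsOracle {M d m : ℕ} {Ξ : Type*} [MeasurableSpace Ξ] (f : Fin M → Pt d m → ℝ)
    (g : Fin M → Pt d m → Ξ → Pt d m) (P : Fin M → Measure Ξ) (σ L : ℝ) : Prop where
  measurable : ∀ i, Measurable (Function.uncurry (g i))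
  integrable : ∀ i z, Integrable (fun s => g i z s) (P i)
  unbiased : ∀ i z, ∫ s, g i z s ∂(P i) = gradient (f i) z
  integrable_sq : ∀ i z, Integrable (fun s => ‖g i z s - gradient (f i) z‖ ^ 2) (P i)
  variance_le : ∀ i z, ∫ s, ‖g i z s - gradient (f i) z‖ ^ 2 ∂(P i) ≤ σ ^ 2
  lipschitz_sq : ∀ i z z', ∫ s, ‖g i z s - g i z' s‖ ^ 2 ∂(P i) ≤ L ^ 2 * ‖z - z'‖ ^ 2

/-- `ξ t ω i s` is the `s`-th sample that agent `i` draws for its gradient estimator of time `t`.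
It has law `P i`; the samples inside one batch are independent, and the batches of different
times are independent. -/
structure IsSampling {M : ℕ} {Ξ Ω : Type*} [MeasurableSpace Ξ] [MeasurableSpace Ω]
    (P : Fin M → Measure Ξ) (μ : Measure Ω) (ξ : ℕ → Ω → Fin M → ℕ → Ξ) : Prop where
  measurable : ∀ t, Measurable (ξ t)
  law : ∀ t i s, μ.map (fun ω => ξ t ω i s) = P i
  indep_batch : ∀ t i, iIndepFun (fun s ω => ξ t ω i s) μ
  indep_time : iIndepFun ξ μ

/-! ### The network -/

/-- The averaging matrix `Π = (1/M) 1 1ᵀ`. -/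
def averagingMatrix (M : ℕ) : Matrix (Fin M) (Fin M) ℝ :=
  Matrix.of fun _ _ => 1 / (M : ℝ)

/-- `ρ = ‖W - Π‖₂`, the spectral norm. -/
def mixingRate {M : ℕ} (W : Matrix (Fin M) (Fin M) ℝ) : ℝ :=
  ‖Matrix.toEuclideanCLM (n := Fin M) (𝕜 := ℝ) (W - averagingMatrix M)‖

/-- `W` is a mixing matrix for the connected (directed) network with edge relation `edge`. -/
structure IsMixing {M : ℕ} (edge : Fin M → Fin M → Prop) (W : Matrix (Fin M) (Fin M) ℝ) :
    Prop where
  connected : ∀ i j, Relation.ReflTransGen edge i j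
  nonneg : ∀ i j, 0 ≤ W i j
  decentralized : ∀ i j, ¬ edge i j → W i j = 0
  row_sum : ∀ i, ∑ j, W i j = 1
  col_sum : ∀ j, ∑ i, W i j = 1
  rate_lt_one : mixingRate W < 1

/-! ### The algorithm -/

/-- Step sizes, batch sizes and period. The phase `r` fixes the times at which the large batch is
used: the estimator of time `t + 1` is a large-batch one if and only if `q ∣ t + r`. -/
structure Params where
  ηx : ℝ
  ηy : ℝ
  S₁ : ℕ
  S₂ : ℕ
  q : ℕ
  r : ℕ

/-- What the agents hold at a given time: `z i` is the iterate `(x_i, y_i)`, `v i` the stochastic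
gradient estimate and `dir i` the gradient tracking variable of agent `i`. -/
structure State (M d m : ℕ) where
  z : Fin M → Pt d m
  v : Fin M → Pt d m
  dir : Fin M → Pt d m

/-- The averaged stochastic gradient of agent `i` at `u i` over the first `S` samples of its
batch. -/
def batchGrad {M d m : ℕ} {Ξ : Type*} (g : Fin M → Pt d m → Ξ → Pt d m) (S : ℕ)
    (u : Fin M → Pt d m) (c : Fin M → ℕ → Ξ) (i : Fin M) : Pt d m :=
  (1 / (S : ℝ)) • ∑ s ∈ Finset.range S, g i (u i) (c i s)

/-- Multiplication of the matrix with rows `u j` by the mixing matrix. -/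
def mix {M d m : ℕ} (W : Matrix (Fin M) (Fin M) ℝ) (u : Fin M → Pt d m) (i : Fin M) : Pt d m :=
  ∑ j, W i j • u j

/-- `X⁺ = W X - ηx D_x` and `Y⁺ = W Y + ηy D_y`. -/
def nextZ {M d m : ℕ} (p : Params) (W : Matrix (Fin M) (Fin M) ℝ) (st : State M d m)
    (i : Fin M) : Pt d m :=
  pt ((mix W st.z i).fst - p.ηx • (st.dir i).fst) ((mix W st.z i).snd + p.ηy • (st.dir i).snd)

/-- The gradient estimators of time `t + 1`, with `c` the samples of that time. -/
def nextV {M d m : ℕ} {Ξ : Type*} (p : Params) (W : Matrix (Fin M) (Fin M) ℝ)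
    (g : Fin M → Pt d m → Ξ → Pt d m) (t : ℕ) (c : Fin M → ℕ → Ξ) (st : State M d m)
    (i : Fin M) : Pt d m :=
  if (t + p.r) % p.q = 0 then
    batchGrad g p.S₁ (nextZ p W st) c i
  else
    batchGrad g p.S₂ (nextZ p W st) c i - batchGrad g p.S₂ st.z c i + st.v i

/-- One iteration, from time `t` to time `t + 1`; the tracking update is `D⁺ = W (D + V⁺ - V)`. -/
def step {M d m : ℕ} {Ξ : Type*} (p : Params) (W : Matrix (Fin M) (Fin M) ℝ)
    (g : Fin M → Pt d m → Ξ → Pt d m) (t : ℕ) (c : Fin M → ℕ → Ξ) (st : State M d m) :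
    State M d m where
  z := nextZ p W st
  v := nextV p W g t c st
  dir := mix W fun i => st.dir i + nextV p W g t c st i - st.v i

/-- The run of the algorithm along the sample path `c`, started at `z₀` with large-batch gradient
estimators and with tracking variables computed by the rule `D₀` from the first batch. -/
def run {M d m : ℕ} {Ξ : Type*} (p : Params) (W : Matrix (Fin M) (Fin M) ℝ)
    (g : Fin M → Pt d m → Ξ → Pt d m) (z₀ : Fin M → Pt d m)
    (D₀ : (Fin M → ℕ → Ξ) → Fin M → Pt d m) (c : ℕ → Fin M → ℕ → Ξ) : ℕ → State M d m
  | 0 => { z := z₀, v := batchGrad g p.S₁ z₀ (c 0), dir := D₀ (c 0) }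
  | t + 1 => step p W g t (c (t + 1)) (run p W g z₀ D₀ c t)

/-- The average primal iterate `x̄^t`, as a random variable. -/
def xbar {M d m : ℕ} {Ξ Ω : Type*} (p : Params) (W : Matrix (Fin M) (Fin M) ℝ)
    (g : Fin M → Pt d m → Ξ → Pt d m) (z₀ : Fin M → Pt d m)
    (D₀ : (Fin M → ℕ → Ξ) → Fin M → Pt d m) (ξ : ℕ → Ω → Fin M → ℕ → Ξ) (t : ℕ) (ω : Ω) :
    EuclideanSpace ℝ (Fin d) :=
  (avg (run p W g z₀ D₀ (fun k => ξ k ω) t).z).fst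

/-- The condition on the step sizes, the batch sizes and the period. -/
structure ParamCondition (p : Params) (L μ ρ : ℝ) : Prop where
  ηx_pos : 0 < p.ηx
  ηy_pos : 0 < p.ηy
  ηy_le : p.ηy ≤ 1 / (32 * √5 * L) *
    min ((1 - ρ) ^ 2) (min (1 / (L / μ)) ((1 - ρ) / √(L / μ)))
  ηx_le : p.ηx ≤ min (1 / (6 * (L / μ + 1) * L))
    (min (p.ηy / (8 * √3 * (L / μ) ^ 2))
      (min (4 / (5 * μ) * p.ηy) (1 / (64 * (L / μ) ^ 2) * p.ηy)))
  S₁_pos : 1 ≤ p.S₁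
  q_pos : 1 ≤ p.q
  q_le_S₂ : p.q ≤ p.S₂

end

end DGDA

namespace DGDA

noncomputable section

/-! ### First-order inequalities for strongly concave and for smooth functions -/

section General

variable {E : Type*} [NormedAddCommGroup E] [InnerProductSpace ℝ E]

/-! The columns of `W` sum to one, so mixing does not change averages and gradient tracking keeps
the average of `D` equal to that of `V` (`Setting.avg_dir`). Hence the averaged iterate performs
ordinary gradient descent-ascent along the averaged estimator (`Setting.avg_z_succ`). The error of
that estimator at the averaged iterate is bounded by the consensus error of the iterates and the
errors of the local estimators (`Setting.avgErr_le`).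

The quantities that matter obey coupled one-step inequalities. The value Φ decreases by a multiple
of ‖∇Φ‖², up to the best-response gap and the estimator error, and a multiple of the squared
x-direction is kept as a reserve (`IsSaddle.max_move_le`). The best-response gap contracts by 1 - ηy
μ / 2, up to the estimator error and the drift of y*, which is κ-Lipschitz
(`IsSaddle.gapSq_move_le`). The consensus errors of Z and D contract by ρ; the first is fed by the
second, the second by the increments of the estimators (`Setting.meanConsZ_succ_le`,
`Setting.meanConsDir_succ_le`). The error of the variance-reduced estimators is σ² / S₁ after a
large batch and grows by at most L² / S₂ times the squared displacement after a small one
(`Setting.sum_meanErr_le`). The displacements are in turn bounded by the consensus errors and the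
averaged directions (`Setting.meanDisp_le`).

No Lyapunov function is used: each inequality is summed over time, which leaves a finite system of
linear inequalities between sums. The step-size conditions make the feedback in this system small,
and `sum_bound` solves it.

The probabilistic input is that the iterate of time t + 1 is determined before the batch of time t +
1 is drawn (`Setting.indepFun_step`). Conditionally on the past, a batch average is therefore a mean
of independent centred vectors around a fixed point, and the cross terms vanish. -/

theorem StrongConcaveOn.le_add_inner_sub {h : E → ℝ} {μ : ℝ} (hc : StrongConcaveOn Set.univ μ h)
    {y y' w : E} (hw : HasDerivAt (fun t : ℝ => h (y + t • (y' - y))) (inner ℝ w (y' - y)) 0) :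
    h y' ≤ h y + inner ℝ w (y' - y) - μ / 2 * ‖y' - y‖ ^ 2 := by
  have h1 := hw.tendsto_slope_zero_right
  -- Strong concavity on the segment from `y` to `y'`, divided by `t`, bounds the difference
  -- quotient below by this expression; then `t → 0⁺`.
  have h2 : Filter.Tendsto (fun t : ℝ => h y' - h y + (1 - t) * (μ / 2 * ‖y' - y‖ ^ 2))
      (nhdsWithin 0 (Set.Ioi 0)) (nhds (h y' - h y + (1 - 0) * (μ / 2 * ‖y' - y‖ ^ 2))) := by
    apply Filter.Tendsto.mono_left _ nhdsWithin_le_nhds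
    exact Continuous.tendsto (by fun_prop) 0
  have h3 := le_of_tendsto_of_tendsto h2 h1 (by
    have hm : Set.Ioo (0 : ℝ) 1 ∈ nhdsWithin (0 : ℝ) (Set.Ioi 0) :=
      Ioo_mem_nhdsGT one_pos
    filter_upwards [hm] with t ht
    have := hc.2 (Set.mem_univ y') (Set.mem_univ y) ht.1.le (sub_nonneg.2 ht.2.le) (by ring)
    have e : t • y' + (1 - t) • y = y + t • (y' - y) := by module
    rw [e] at this
    simp only [smul_eq_mul, zero_add, zero_smul, add_zero] at this ⊢
    rw [le_inv_mul_iff₀ ht.1]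
    linarith)
  linarith

theorem continuous_of_differentiable {h : E → ℝ} (hh : Differentiable ℝ h) : Continuous h :=
  hh.continuous

variable [CompleteSpace E]

/-- Mean value inequality on the segment, applied to `F` minus its linearisation at `z`. The sharp
constant would be L / 2; the cruder L is enough for everything that follows. -/
theorem abs_sub_sub_inner_gradient_le {F : E → ℝ} {L : ℝ} (hL : 0 ≤ L) (hF : Differentiable ℝ F)
    (hLip : ∀ z z', ‖gradient F z - gradient F z'‖ ≤ L * ‖z - z'‖) (z z' : E) :
    |F z' - F z - inner ℝ (gradient F z) (z' - z)| ≤ L * ‖z' - z‖ ^ 2 := by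
  have key := (convex_segment z z').norm_image_sub_le_of_norm_fderiv_le' (𝕜 := ℝ) (f := F)
    (φ := fderiv ℝ F z) (C := L * ‖z' - z‖) (fun x _ => hF x) (by
      intro x hx
      have e : fderiv ℝ F x - fderiv ℝ F z
          = InnerProductSpace.toDual ℝ E (gradient F x - gradient F z) := by
        simp [gradient]
      rw [e, LinearIsometryEquiv.norm_map]
      refine (hLip x z).trans (mul_le_mul_of_nonneg_left ?_ hL)
      rw [segment_eq_image'] at hx
      obtain ⟨θ, hθ, rfl⟩ := hx
      simp only [add_sub_cancel_left, norm_smul, Real.norm_eq_abs, abs_of_nonneg hθ.1]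
      exact mul_le_of_le_one_left (norm_nonneg _) hθ.2)
    (left_mem_segment ℝ z z') (right_mem_segment ℝ z z')
  rw [inner_gradient_left, ← Real.norm_eq_abs]
  refine key.trans (le_of_eq (by ring))

end General

/-! ### The primal function: best response, Danskin's theorem -/

section Primal

variable {d m : ℕ}

@[simp] theorem pt_fst (x : EuclideanSpace ℝ (Fin d)) (y : EuclideanSpace ℝ (Fin m)) :
    (pt x y).fst = x := rfl

@[simp] theorem pt_snd (x : EuclideanSpace ℝ (Fin d)) (y : EuclideanSpace ℝ (Fin m)) :
    (pt x y).snd = y := rfl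

theorem pt_fst_snd (z : Pt d m) : pt z.fst z.snd = z := rfl

theorem norm_sq_pt (z : Pt d m) : ‖z‖ ^ 2 = ‖z.fst‖ ^ 2 + ‖z.snd‖ ^ 2 :=
  WithLp.prod_norm_sq_eq_of_L2 z

theorem inner_pt (z w : Pt d m) :
    inner ℝ z w = inner ℝ z.fst w.fst + inner ℝ z.snd w.snd :=
  WithLp.prod_inner_apply z w

theorem norm_fst_le (z : Pt d m) : ‖z.fst‖ ≤ ‖z‖ := by
  have := norm_sq_pt z
  exact (sq_le_sq₀ (norm_nonneg _) (norm_nonneg _)).1 (by nlinarith [sq_nonneg ‖z.snd‖])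

theorem norm_snd_le (z : Pt d m) : ‖z.snd‖ ≤ ‖z‖ := by
  have := norm_sq_pt z
  exact (sq_le_sq₀ (norm_nonneg _) (norm_nonneg _)).1 (by nlinarith [sq_nonneg ‖z.fst‖])

/-- A differentiable function of `(x, y)` with an `L`-Lipschitz gradient that satisfies the
first-order condition of `μ`-strong concavity in `y`. -/
structure IsSaddle (F : Pt d m → ℝ) (L μ : ℝ) : Prop where
  L_pos : 0 < L
  μ_pos : 0 < μ
  differentiable : Differentiable ℝ F
  lipschitz : ∀ z z', ‖gradient F z - gradient F z'‖ ≤ L * ‖z - z'‖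
  concave : ∀ x y y', F (pt x y') ≤ F (pt x y)
    + inner ℝ (gradient F (pt x y)).snd (y' - y) - μ / 2 * ‖y' - y‖ ^ 2

/-- The maximiser of `F(x, ·)`. -/
def argmax (F : Pt d m → ℝ) (x : EuclideanSpace ℝ (Fin d)) : EuclideanSpace ℝ (Fin m) :=
  Classical.epsilon fun y => IsMaxOn (fun y => F (pt x y)) Set.univ y

namespace IsSaddle

variable {F : Pt d m → ℝ} {L μ : ℝ} (hF : IsSaddle F L μ)
include hF

/-- Sum of the two concavity inequalities with the roles of `y` and `y'` exchanged. -/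
theorem monotone (x : EuclideanSpace ℝ (Fin d)) (y y' : EuclideanSpace ℝ (Fin m)) :
    inner ℝ ((gradient F (pt x y)).snd - (gradient F (pt x y')).snd) (y - y')
      ≤ - μ * ‖y - y'‖ ^ 2 := by
  have h1 := hF.concave x y y'
  have h2 := hF.concave x y' y
  rw [inner_sub_left]
  have h3 : inner ℝ (gradient F (pt x y)).snd (y' - y)
      = - inner ℝ (gradient F (pt x y)).snd (y - y') := by
    rw [← inner_neg_right, neg_sub]
  rw [norm_sub_rev y' y] at h1
  linarith

theorem norm_gradient_fst_sub_le (x : EuclideanSpace ℝ (Fin d)) (y y' : EuclideanSpace ℝ (Fin m)) :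
    ‖gradient F (pt x y) - gradient F (pt x y')‖ ≤ L * ‖y - y'‖ := by
  refine (hF.lipschitz _ _).trans_eq ?_
  congr 1
  have : ‖pt x y - pt x y'‖ ^ 2 = ‖y - y'‖ ^ 2 := by
    rw [norm_sq_pt]; simp
  exact (sq_eq_sq₀ (norm_nonneg _) (norm_nonneg _)).1 this

/-- Along a unit vector in the y-space, strong concavity makes the gradient vary at rate at least μ
and the Lipschitz bound at rate at most L. A unit vector exists only if `0 < m`. -/
theorem one_le_cond (hm : 0 < m) : 1 ≤ L / μ := by
  rw [one_le_div hF.μ_pos]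
  let y : EuclideanSpace ℝ (Fin m) := EuclideanSpace.single ⟨0, hm⟩ 1
  have hy : ‖y‖ = 1 := by simp [y]
  have h1 := hF.monotone 0 y 0
  have h2 := (norm_snd_le _).trans (hF.norm_gradient_fst_sub_le 0 y 0)
  have h3 := neg_le_of_abs_le (abs_real_inner_le_norm ((gradient F (pt 0 y)).snd
    - (gradient F (pt 0 (0 : EuclideanSpace ℝ (Fin m)))).snd) (y - 0))
  simp only [sub_zero, hy, WithLp.sub_snd] at h1 h2 h3
  linarith

/-- Outside the ball of radius 2‖∇_y F(x, 0)‖ / μ the quadratic term beats the linear one, so values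
there do not exceed F(x, 0). A maximiser on the compact ball is thus a global one. -/
theorem exists_isMaxOn (x : EuclideanSpace ℝ (Fin d)) :
    ∃ y, IsMaxOn (fun y => F (pt x y)) Set.univ y := by
  have hcont : Continuous fun y => F (pt x y) := by
    have h1 : Continuous F := continuous_of_differentiable hF.differentiable
    have h2 : Continuous fun y : EuclideanSpace ℝ (Fin m) => pt x y :=
      (WithLp.prod_continuous_toLp 2 _ _).comp (by fun_prop)
    exact h1.comp h2
  set R := 2 * ‖(gradient F (pt x (0 : EuclideanSpace ℝ (Fin m)))).snd‖ / μ with hR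
  have hR0 : 0 ≤ R := by have := hF.μ_pos; positivity
  obtain ⟨y, hy, hmax⟩ := (isCompact_closedBall (0 : EuclideanSpace ℝ (Fin m)) R).exists_isMaxOn
    ⟨0, by simpa using hR0⟩ hcont.continuousOn
  refine ⟨y, fun y' _ => ?_⟩
  by_cases h : ‖y'‖ ≤ R
  · exact hmax (by simpa using h)
  · have h0 : F (pt x 0) ≤ F (pt x y) := hmax (by simpa using hR0)
    refine le_trans ?_ h0
    have h1 := hF.concave x 0 y'
    have h2 := real_inner_le_norm (gradient F (pt x (0 : EuclideanSpace ℝ (Fin m)))).snd (y' - 0)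
    rw [sub_zero] at h1 h2
    have h3 : 2 * ‖(gradient F (pt x (0 : EuclideanSpace ℝ (Fin m)))).snd‖ = R * μ := by
      rw [hR]; field_simp [hF.μ_pos.ne']
    have h4 : R * μ * ‖y'‖ ≤ μ * ‖y'‖ ^ 2 := by
      have := mul_le_mul_of_nonneg_left (not_le.1 h).le (mul_nonneg hF.μ_pos.le (norm_nonneg y'))
      linarith
    have h5 : F (pt x y') ≤ F (pt x 0) := by nlinarith
    exact h5

theorem isMaxOn_argmax (x : EuclideanSpace ℝ (Fin d)) :
    IsMaxOn (fun y => F (pt x y)) Set.univ (argmax F x) :=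
  Classical.epsilon_spec (hF.exists_isMaxOn x)

theorem le_argmax (x : EuclideanSpace ℝ (Fin d)) (y : EuclideanSpace ℝ (Fin m)) :
    F (pt x y) ≤ F (pt x (argmax F x)) :=
  hF.isMaxOn_argmax x (Set.mem_univ y)

theorem iSup_eq (x : EuclideanSpace ℝ (Fin d)) :
    ⨆ y, F (pt x y) = F (pt x (argmax F x)) :=
  le_antisymm (ciSup_le (hF.le_argmax x))
    (le_ciSup (f := fun y => F (pt x y)) ⟨_, by rintro _ ⟨y, rfl⟩; exact hF.le_argmax x y⟩ _)

/-- Otherwise an ascent step of length 1 / (2L) along the y-gradient w would raise the value by at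
least ‖w‖² / (4L). -/
theorem gradient_argmax_snd (x : EuclideanSpace ℝ (Fin d)) :
    (gradient F (pt x (argmax F x))).snd = 0 := by
  set w := (gradient F (pt x (argmax F x))).snd with hw
  by_contra hne
  have hpos : 0 < ‖w‖ ^ 2 := by positivity
  have hL := hF.L_pos
  have h1 := hF.le_argmax x (argmax F x + (1 / (2 * L)) • w)
  have h2 := neg_le_of_abs_le (abs_sub_sub_inner_gradient_le hF.L_pos.le hF.differentiable
    hF.lipschitz (pt x (argmax F x)) (pt x (argmax F x + (1 / (2 * L)) • w)))
  have e1 : ‖pt x (argmax F x + (1 / (2 * L)) • w) - pt x (argmax F x)‖ ^ 2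
      = (1 / (2 * L)) ^ 2 * ‖w‖ ^ 2 := by
    rw [norm_sq_pt]
    simp [norm_smul, mul_pow]
  have e2 : inner ℝ (gradient F (pt x (argmax F x)))
      (pt x (argmax F x + (1 / (2 * L)) • w) - pt x (argmax F x)) = 1 / (2 * L) * ‖w‖ ^ 2 := by
    rw [inner_pt, ← hw]
    simp [inner_smul_right]
  rw [e1, e2] at h2
  have : L * ((1 / (2 * L)) ^ 2 * ‖w‖ ^ 2) = 1 / (4 * L) * ‖w‖ ^ 2 := by field_simp; ring
  have h3 : 1 / (2 * L) * ‖w‖ ^ 2 = 2 * (1 / (4 * L) * ‖w‖ ^ 2) := by field_simp; ring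
  have h4 : 0 < 1 / (4 * L) * ‖w‖ ^ 2 := by positivity
  linarith

/-- Strong monotonicity at the fixed point x, between the two best responses: the y-gradient
vanishes at (x, y*(x)), and at (x, y*(x')) it is at most L‖x - x'‖ because it vanishes at (x',
y*(x')). -/
theorem norm_argmax_sub_le (x x' : EuclideanSpace ℝ (Fin d)) :
    ‖argmax F x - argmax F x'‖ ≤ L / μ * ‖x - x'‖ := by
  have hμ := hF.μ_pos
  set a := argmax F x with ha
  set b := argmax F x' with hb
  have h1 := hF.monotone x a b
  have h0 : (gradient F (pt x a)).snd = 0 := hF.gradient_argmax_snd x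
  have h0' : (gradient F (pt x' b)).snd = 0 := hF.gradient_argmax_snd x'
  have h2 : ‖(gradient F (pt x b)).snd‖ ≤ L * ‖x - x'‖ := by
    have h := (norm_snd_le _).trans (hF.lipschitz (pt x b) (pt x' b))
    rw [WithLp.sub_snd, h0', sub_zero] at h
    refine h.trans_eq ?_
    congr 1
    have : ‖pt x b - pt x' b‖ ^ 2 = ‖x - x'‖ ^ 2 := by
      rw [norm_sq_pt]; simp
    exact (sq_eq_sq₀ (norm_nonneg _) (norm_nonneg _)).1 this
  rw [h0, zero_sub, inner_neg_left] at h1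
  have h3 := real_inner_le_norm (gradient F (pt x b)).snd (a - b)
  have h4 : μ * ‖a - b‖ ^ 2 ≤ L * ‖x - x'‖ * ‖a - b‖ := by
    nlinarith [mul_le_mul_of_nonneg_right h2 (norm_nonneg (a - b))]
  rcases eq_or_lt_of_le (norm_nonneg (a - b)) with h | h
  · rw [← h]; have := hF.L_pos; positivity
  · rw [div_mul_eq_mul_div, le_div_iff₀ hμ]
    nlinarith

/-- First-order expansion of `x ↦ max_y F(x, y)`, with a quadratic remainder. -/
theorem abs_max_sub_sub_inner_le (x x' : EuclideanSpace ℝ (Fin d)) :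
    |F (pt x' (argmax F x')) - F (pt x (argmax F x))
      - inner ℝ (gradient F (pt x (argmax F x))).fst (x' - x)|
        ≤ L * (1 + (L / μ) ^ 2) * ‖x' - x‖ ^ 2 := by
  have hL := hF.L_pos
  -- The lower bound tests the maximum at `x'` with the old maximiser; the upper bound expands `F`
  -- up to the new one. Both expansions start at a point whose y-gradient is zero, so only the
  -- x-part of the linear term survives.
  have h1 := (abs_le.1 (abs_sub_sub_inner_gradient_le hL.le hF.differentiable
    hF.lipschitz (pt x (argmax F x)) (pt x' (argmax F x)))).1
  have h2 := (abs_le.1 (abs_sub_sub_inner_gradient_le hL.le hF.differentiable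
    hF.lipschitz (pt x (argmax F x)) (pt x' (argmax F x')))).2
  have h3 := hF.le_argmax x' (argmax F x)
  have h4 := hF.norm_argmax_sub_le x' x
  have h5 : ‖argmax F x' - argmax F x‖ ^ 2 ≤ (L / μ) ^ 2 * ‖x' - x‖ ^ 2 := by
    rw [← mul_pow]; exact pow_le_pow_left₀ (norm_nonneg _) h4 2
  rw [inner_pt, hF.gradient_argmax_snd, norm_sq_pt] at h1 h2
  simp only [WithLp.sub_fst, WithLp.sub_snd, pt_fst, pt_snd, inner_zero_left, sub_self,
    norm_zero] at h1 h2
  have h6 := mul_le_mul_of_nonneg_left h5 hL.le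
  have h7 : 0 ≤ L * ((L / μ) ^ 2 * ‖x' - x‖ ^ 2) := by positivity
  rw [abs_le]
  constructor <;> nlinarith

theorem hasGradientAt_max (x : EuclideanSpace ℝ (Fin d)) :
    HasGradientAt (fun x => F (pt x (argmax F x))) (gradient F (pt x (argmax F x))).fst x := by
  rw [hasGradientAt_iff_isLittleO]
  refine Asymptotics.IsBigO.trans_isLittleO (g := fun x' => ‖x' - x‖ ^ 2) ?_ ?_
  · refine Asymptotics.IsBigO.of_bound (L * (1 + (L / μ) ^ 2)) (Filter.Eventually.of_forall ?_)
    intro x'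
    rw [Real.norm_eq_abs, Real.norm_eq_abs, abs_of_nonneg (sq_nonneg ‖x' - x‖)]
    exact hF.abs_max_sub_sub_inner_le x x'
  · have h : Filter.Tendsto (fun x' => ‖x' - x‖) (nhds x) (nhds 0) := by
      have : Continuous fun x' : EuclideanSpace ℝ (Fin d) => ‖x' - x‖ := by fun_prop
      simpa using this.tendsto x
    have h2 := ((Asymptotics.isLittleO_one_iff ℝ).2 h).mul_isBigO
      (Asymptotics.isBigO_refl (fun x' => ‖x' - x‖) (nhds x))
    simp only [one_mul, ← sq] at h2
    exact h2.trans_isBigO (Asymptotics.isBigO_norm_left.2 (Asymptotics.isBigO_refl _ _))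

end IsSaddle

end Primal

/-! ### Averages and the spectral norm acting on vector-valued rows -/

section Average

variable {E : Type*} [NormedAddCommGroup E] [InnerProductSpace ℝ E] {M : ℕ}

theorem norm_add_sq_le_two (a b : E) : ‖a + b‖ ^ 2 ≤ 2 * ‖a‖ ^ 2 + 2 * ‖b‖ ^ 2 := by
  nlinarith [parallelogram_law_with_norm ℝ a b, norm_nonneg (a - b), mul_self_nonneg ‖a - b‖]

theorem norm_sub_sq_le_two (a b : E) : ‖a - b‖ ^ 2 ≤ 2 * ‖a‖ ^ 2 + 2 * ‖b‖ ^ 2 := by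
  nlinarith [parallelogram_law_with_norm ℝ a b, norm_nonneg (a + b), mul_self_nonneg ‖a + b‖]

theorem norm_add_sq_le_young {θ : ℝ} (hθ : 0 < θ) (a b : E) :
    ‖a + b‖ ^ 2 ≤ (1 + θ) * ‖a‖ ^ 2 + (1 + 1 / θ) * ‖b‖ ^ 2 := by
  have h1 := norm_add_sq_real a b
  have h2 := real_inner_le_norm a b
  have h3 : 2 * (‖a‖ * ‖b‖) ≤ θ * ‖a‖ ^ 2 + 1 / θ * ‖b‖ ^ 2 := by
    have : 0 ≤ (θ * ‖a‖ - ‖b‖) ^ 2 / θ := by positivity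
    have e : (θ * ‖a‖ - ‖b‖) ^ 2 / θ
        = θ * ‖a‖ ^ 2 + 1 / θ * ‖b‖ ^ 2 - 2 * (‖a‖ * ‖b‖) := by
      field_simp; ring
    linarith
  linarith

theorem avg_add (u v : Fin M → E) : avg (fun i => u i + v i) = avg u + avg v := by
  simp [avg, Finset.sum_add_distrib, smul_add]

theorem avg_sub (u v : Fin M → E) : avg (fun i => u i - v i) = avg u - avg v := by
  simp [avg, Finset.sum_sub_distrib, smul_sub]

theorem avg_const (hM : 0 < M) (a : E) : avg (fun _ : Fin M => a) = a := by
  have : (M : ℝ) ≠ 0 := by positivity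
  rw [avg, Finset.sum_const, Finset.card_univ, Fintype.card_fin, ← Nat.cast_smul_eq_nsmul ℝ,
    smul_smul, one_div_mul_cancel this, one_smul]

theorem norm_avg_sq_le (hM : 0 < M) (u : Fin M → E) :
    ‖avg u‖ ^ 2 ≤ 1 / (M : ℝ) * ∑ i, ‖u i‖ ^ 2 := by
  have hM' : (0 : ℝ) < M := by positivity
  have h1 : ‖∑ i, u i‖ ^ 2 ≤ M * ∑ i, ‖u i‖ ^ 2 := by
    refine (pow_le_pow_left₀ (norm_nonneg _) (norm_sum_le _ _) 2).trans ?_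
    simpa using sq_sum_le_card_mul_sum_sq (s := Finset.univ) (f := fun i => ‖u i‖)
  rw [avg, norm_smul, mul_pow, Real.norm_eq_abs, abs_of_pos (by positivity)]
  calc (1 / (M : ℝ)) ^ 2 * ‖∑ i, u i‖ ^ 2
      ≤ (1 / (M : ℝ)) ^ 2 * (M * ∑ i, ‖u i‖ ^ 2) := by gcongr
    _ = _ := by field_simp

/-- In an orthonormal basis of `E` the matrix acts on each coordinate separately, as on an ordinary
real vector, so the operator norm does not see the dimension of `E`. -/
theorem sum_norm_sq_matrix_smul_le [FiniteDimensional ℝ E] (A : Matrix (Fin M) (Fin M) ℝ)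
    (u : Fin M → E) :
    ∑ i, ‖∑ j, A i j • u j‖ ^ 2
      ≤ ‖Matrix.toEuclideanCLM (n := Fin M) (𝕜 := ℝ) A‖ ^ 2 * ∑ j, ‖u j‖ ^ 2 := by
  let b := stdOrthonormalBasis ℝ E
  have h0 : ∀ w : E, ‖w‖ ^ 2 = ∑ k, inner ℝ (b k) w ^ 2 := fun w => by
    rw [← b.sum_sq_norm_inner_right w]
    simp
  have h1 : ∀ k, ∑ i, inner ℝ (b k) (∑ j, A i j • u j) ^ 2
      ≤ ‖Matrix.toEuclideanCLM (n := Fin M) (𝕜 := ℝ) A‖ ^ 2 * ∑ j, inner ℝ (b k) (u j) ^ 2 := by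
    intro k
    let w : EuclideanSpace ℝ (Fin M) := WithLp.toLp 2 fun j => inner ℝ (b k) (u j)
    have h := (Matrix.toEuclideanCLM (n := Fin M) (𝕜 := ℝ) A).le_opNorm w
    have h2 := pow_le_pow_left₀ (norm_nonneg _) h 2
    rw [mul_pow, EuclideanSpace.norm_sq_eq, EuclideanSpace.norm_sq_eq] at h2
    have e1 : ∀ i, A.mulVec (fun j => inner ℝ (b k) (u j)) i
        = inner ℝ (b k) (∑ j, A i j • u j) := fun i => by
      simp [inner_sum, inner_smul_right, Matrix.mulVec, dotProduct]
    simpa [e1, w, Matrix.toEuclideanCLM_toLp] using h2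
  calc ∑ i, ‖∑ j, A i j • u j‖ ^ 2
      = ∑ k, ∑ i, inner ℝ (b k) (∑ j, A i j • u j) ^ 2 := by
        rw [Finset.sum_comm]; exact Finset.sum_congr rfl fun i _ => h0 _
    _ ≤ ∑ k, ‖Matrix.toEuclideanCLM (n := Fin M) (𝕜 := ℝ) A‖ ^ 2
          * ∑ j, inner ℝ (b k) (u j) ^ 2 := Finset.sum_le_sum fun k _ => h1 k
    _ = _ := by
        rw [← Finset.mul_sum, Finset.sum_comm]
        congr 1
        exact Finset.sum_congr rfl fun i _ => (h0 _).symm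

theorem sum_mul_smul_sub (W : Matrix (Fin M) (Fin M) ℝ) (u : Fin M → E) (i : Fin M) :
    ∑ j, W i j • u j - avg u = ∑ j, (W - averagingMatrix M) i j • u j := by
  simp [averagingMatrix, sub_smul, Finset.sum_sub_distrib, avg, Finset.smul_sum]

/-- Unit row sums make `W - Π` annihilate constant families, so the rows may be centred. This is
what turns the spectral norm into a contraction of the consensus error. -/
theorem sum_mul_smul_sub_avg (hM : 0 < M) (W : Matrix (Fin M) (Fin M) ℝ)
    (hrow : ∀ i, ∑ j, W i j = 1) (u : Fin M → E) (i : Fin M) :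
    ∑ j, W i j • u j - avg u = ∑ j, (W - averagingMatrix M) i j • (u j - avg u) := by
  have h := sum_mul_smul_sub W (fun j => u j - avg u) i
  rw [← h, avg_sub, avg_const hM, sub_self, sub_zero]
  simp only [smul_sub, Finset.sum_sub_distrib, ← Finset.sum_smul, hrow, one_smul]

theorem avg_sum_mul_smul (W : Matrix (Fin M) (Fin M) ℝ) (hcol : ∀ j, ∑ i, W i j = 1)
    (u : Fin M → E) : avg (fun i => ∑ j, W i j • u j) = avg u := by
  simp only [avg]
  rw [Finset.sum_comm]
  simp only [← Finset.sum_smul, hcol, one_smul]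

end Average

/-! ### Deterministic one-step bounds for consensus errors and displacements -/

section Pathwise

variable {M d m : ℕ}

theorem mixingRate_nonneg (W : Matrix (Fin M) (Fin M) ℝ) : 0 ≤ mixingRate W := norm_nonneg _

theorem consensusErr_nonneg (u : Fin M → Pt d m) : 0 ≤ consensusErr u :=
  Finset.sum_nonneg fun _ _ => sq_nonneg _

theorem sum_norm_mix_sub_avg_le (hM : 0 < M) {W : Matrix (Fin M) (Fin M) ℝ}
    (hrow : ∀ i, ∑ j, W i j = 1) (u : Fin M → Pt d m) :
    ∑ i, ‖mix W u i - avg u‖ ^ 2 ≤ mixingRate W ^ 2 * consensusErr u := by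
  simp only [mix, sum_mul_smul_sub_avg hM W hrow]
  exact sum_norm_sq_matrix_smul_le _ _

/-- The version without centring, for estimator increments, whose individual norms are what is
controlled. -/
theorem sum_norm_mix_sub_avg_le_sum {W : Matrix (Fin M) (Fin M) ℝ} (u : Fin M → Pt d m) :
    ∑ i, ‖mix W u i - avg u‖ ^ 2 ≤ mixingRate W ^ 2 * ∑ i, ‖u i‖ ^ 2 := by
  simp only [mix, sum_mul_smul_sub]
  exact sum_norm_sq_matrix_smul_le _ _

theorem avg_mix {W : Matrix (Fin M) (Fin M) ℝ} (hcol : ∀ j, ∑ i, W i j = 1)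
    (u : Fin M → Pt d m) : avg (mix W u) = avg u :=
  avg_sum_mul_smul W hcol u

/-- The move `(-ηx • a, ηy • b)` made along the direction `(a, b)`. -/
def move (p : Params) (a : Pt d m) : Pt d m := pt (-(p.ηx • a.fst)) (p.ηy • a.snd)

@[simp] theorem move_fst (p : Params) (a : Pt d m) : (move p a).fst = -(p.ηx • a.fst) := rfl

@[simp] theorem move_snd (p : Params) (a : Pt d m) : (move p a).snd = p.ηy • a.snd := rfl

theorem pt_ext {a b : Pt d m} (h1 : a.fst = b.fst) (h2 : a.snd = b.snd) : a = b := by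
  rw [← pt_fst_snd a, ← pt_fst_snd b, h1, h2]

theorem move_sub (p : Params) (a b : Pt d m) : move p a - move p b = move p (a - b) :=
  pt_ext (by simp [smul_sub]; abel) (by simp [smul_sub])

theorem move_add (p : Params) (a b : Pt d m) : move p a + move p b = move p (a + b) :=
  pt_ext (by simp [smul_add]; abel) (by simp [smul_add])

/-- `move` as a linear map. -/
def moveLin (p : Params) : Pt d m →ₗ[ℝ] Pt d m where
  toFun := move p
  map_add' a b := (move_add p a b).symm
  map_smul' c a := pt_ext
    (show -(p.ηx • (c • a.fst)) = c • -(p.ηx • a.fst) by rw [smul_neg, smul_comm])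
    (show p.ηy • (c • a.snd) = c • (p.ηy • a.snd) by rw [smul_comm])

theorem avg_move (p : Params) (u : Fin M → Pt d m) :
    avg (fun i => move p (u i)) = move p (avg u) := by
  change _ = moveLin p (avg u)
  simp only [avg, map_smul, map_sum]
  rfl

theorem norm_move_sq (p : Params) (a : Pt d m) :
    ‖move p a‖ ^ 2 = p.ηx ^ 2 * ‖a.fst‖ ^ 2 + p.ηy ^ 2 * ‖a.snd‖ ^ 2 := by
  rw [norm_sq_pt]
  simp [norm_smul, mul_pow]

theorem norm_move_sq_le {p : Params} (h0 : 0 ≤ p.ηx) (h : p.ηx ≤ p.ηy) (a : Pt d m) :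
    ‖move p a‖ ^ 2 ≤ p.ηy ^ 2 * ‖a‖ ^ 2 := by
  rw [norm_move_sq, norm_sq_pt a, mul_add]
  gcongr

theorem nextZ_eq (p : Params) (W : Matrix (Fin M) (Fin M) ℝ) (st : State M d m) (i : Fin M) :
    nextZ p W st i = mix W st.z i + move p (st.dir i) :=
  pt_ext (by simp [nextZ, sub_eq_add_neg]) (by simp [nextZ])

theorem avg_nextZ (p : Params) {W : Matrix (Fin M) (Fin M) ℝ} (hcol : ∀ j, ∑ i, W i j = 1)
    (st : State M d m) : avg (nextZ p W st) = avg st.z + move p (avg st.dir) := by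
  have : nextZ p W st = fun i => mix W st.z i + move p (st.dir i) :=
    funext (nextZ_eq p W st)
  rw [this, avg_add, avg_move, avg_mix hcol]

/-- Young's inequality with θ = 1 - ρ: (2 - ρ)ρ² ≤ ρ because (1 - ρ)² ≥ 0, and 1 + 1 / (1 - ρ) ≤ 2 /
(1 - ρ). One factor ρ of ρ² is given up to pay for the perturbation. -/
theorem sum_norm_add_sq_le {ρ : ℝ} (h0 : 0 ≤ ρ) (h1 : ρ < 1) (a b : Fin M → Pt d m) {A : ℝ}
    (hA : 0 ≤ A) (ha : ∑ i, ‖a i‖ ^ 2 ≤ ρ ^ 2 * A) :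
    ∑ i, ‖a i + b i‖ ^ 2 ≤ ρ * A + 2 / (1 - ρ) * ∑ i, ‖b i‖ ^ 2 := by
  have hg : 0 < 1 - ρ := by linarith
  have h2 : ∑ i, ‖a i + b i‖ ^ 2
      ≤ (1 + (1 - ρ)) * ∑ i, ‖a i‖ ^ 2 + (1 + 1 / (1 - ρ)) * ∑ i, ‖b i‖ ^ 2 := by
    rw [Finset.mul_sum, Finset.mul_sum, ← Finset.sum_add_distrib]
    exact Finset.sum_le_sum fun i _ => norm_add_sq_le_young hg _ _
  have h3 : (1 + (1 - ρ)) * ∑ i, ‖a i‖ ^ 2 ≤ ρ * A := by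
    refine (mul_le_mul_of_nonneg_left ha (by linarith)).trans ?_
    have : 0 ≤ ρ * A * (1 - ρ) ^ 2 := by positivity
    nlinarith
  have h4 : 1 + 1 / (1 - ρ) ≤ 2 / (1 - ρ) := by
    rw [← sub_nonneg]
    have : 2 / (1 - ρ) - (1 + 1 / (1 - ρ)) = ρ / (1 - ρ) := by field_simp; ring
    rw [this]; positivity
  have h5 : 0 ≤ ∑ i, ‖b i‖ ^ 2 := Finset.sum_nonneg fun _ _ => sq_nonneg _
  nlinarith [mul_le_mul_of_nonneg_right h4 h5]

variable {W : Matrix (Fin M) (Fin M) ℝ} {p : Params}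

theorem consensusErr_nextZ_le (hM : 0 < M) (hrow : ∀ i, ∑ j, W i j = 1)
    (hcol : ∀ j, ∑ i, W i j = 1) (hρ : mixingRate W < 1) (h0 : 0 ≤ p.ηx) (h : p.ηx ≤ p.ηy)
    (st : State M d m) :
    consensusErr (nextZ p W st) ≤ mixingRate W * consensusErr st.z
      + 2 / (1 - mixingRate W) * (p.ηy ^ 2 * consensusErr st.dir) := by
  have hg : 0 < 1 - mixingRate W := by linarith
  have e : consensusErr (nextZ p W st)
      = ∑ i, ‖(mix W st.z i - avg st.z) + move p (st.dir i - avg st.dir)‖ ^ 2 := by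
    rw [consensusErr, avg_nextZ p hcol]
    refine Finset.sum_congr rfl fun i _ => ?_
    rw [nextZ_eq, ← move_sub]
    congr 2; abel
  rw [e]
  refine (sum_norm_add_sq_le (mixingRate_nonneg W) hρ _ _ (consensusErr_nonneg _)
    (sum_norm_mix_sub_avg_le hM hrow st.z)).trans ?_
  gcongr
  rw [consensusErr, Finset.mul_sum]
  exact Finset.sum_le_sum fun i _ => norm_move_sq_le h0 h _

theorem consensusErr_mix_add_le (hM : 0 < M) (hrow : ∀ i, ∑ j, W i j = 1)
    (hcol : ∀ j, ∑ i, W i j = 1) (hρ : mixingRate W < 1) (a b : Fin M → Pt d m) :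
    consensusErr (mix W fun i => a i + b i) ≤ mixingRate W * consensusErr a
      + 2 / (1 - mixingRate W) * ∑ i, ‖b i‖ ^ 2 := by
  have hg : 0 < 1 - mixingRate W := by linarith
  have e : consensusErr (mix W fun i => a i + b i)
      = ∑ i, ‖(mix W a i - avg a) + (mix W b i - avg b)‖ ^ 2 := by
    rw [consensusErr, avg_mix hcol, avg_add]
    refine Finset.sum_congr rfl fun i _ => ?_
    have : mix W (fun i => a i + b i) i = mix W a i + mix W b i := by
      simp [mix, smul_add, Finset.sum_add_distrib]
    rw [this]
    congr 2; abel
  rw [e]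
  refine (sum_norm_add_sq_le (mixingRate_nonneg W) hρ _ _ (consensusErr_nonneg _)
    (sum_norm_mix_sub_avg_le hM hrow a)).trans ?_
  refine add_le_add le_rfl (mul_le_mul_of_nonneg_left ?_ (by positivity))
  refine (sum_norm_mix_sub_avg_le_sum (W := W) b).trans ?_
  refine mul_le_of_le_one_left (Finset.sum_nonneg fun _ _ => sq_nonneg _) ?_
  exact pow_le_one₀ (mixingRate_nonneg W) hρ.le

theorem sum_norm_nextZ_sub_le (hM : 0 < M) (hrow : ∀ i, ∑ j, W i j = 1)
    (hρ : mixingRate W < 1) (h0 : 0 ≤ p.ηx) (h : p.ηx ≤ p.ηy) (st : State M d m) :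
    1 / (M : ℝ) * ∑ i, ‖nextZ p W st i - st.z i‖ ^ 2
      ≤ 3 * (4 * (1 / (M : ℝ) * consensusErr st.z)
        + p.ηy ^ 2 * (1 / (M : ℝ) * consensusErr st.dir)
        + p.ηx ^ 2 * ‖(avg st.dir).fst‖ ^ 2 + p.ηy ^ 2 * ‖(avg st.dir).snd‖ ^ 2) := by
  have hM' : (0 : ℝ) < M := by positivity
  have h1 : ∀ i, ‖nextZ p W st i - st.z i‖ ^ 2 ≤ 6 * ‖mix W st.z i - avg st.z‖ ^ 2
      + 6 * ‖st.z i - avg st.z‖ ^ 2 + 3 * p.ηy ^ 2 * ‖st.dir i - avg st.dir‖ ^ 2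
      + 3 * ‖move p (avg st.dir)‖ ^ 2 := by
    intro i
    have e : nextZ p W st i - st.z i = ((mix W st.z i - avg st.z) - (st.z i - avg st.z))
        + (move p (st.dir i - avg st.dir) + move p (avg st.dir)) := by
      rw [nextZ_eq, ← move_sub]; abel
    rw [e]
    -- θ = 1 / 2 gives weight 3 / 2 to the two moves and 3 to the two consensus deviations;
    -- splitting each pair doubles these to 3 and 6. The two 6's add up to the 3 · 4 of the
    -- conclusion, since mixing does not increase the consensus error.
    have a1 := norm_add_sq_le_young (θ := 1 / 2) (by norm_num)
      ((move p (st.dir i - avg st.dir) + move p (avg st.dir)))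
      ((mix W st.z i - avg st.z) - (st.z i - avg st.z))
    have a2 := norm_add_sq_le_two (move p (st.dir i - avg st.dir)) (move p (avg st.dir))
    have a3 := norm_sub_sq_le_two (mix W st.z i - avg st.z) (st.z i - avg st.z)
    have a4 := norm_move_sq_le h0 h (st.dir i - avg st.dir)
    rw [add_comm, show (1 + 1 / 2 : ℝ) = 3 / 2 by norm_num,
      show (1 + 1 / (1 / 2) : ℝ) = 3 by norm_num] at a1
    linarith
  have h2 := Finset.sum_le_sum fun i (_ : i ∈ Finset.univ) => h1 i
  simp only [Finset.sum_add_distrib, ← Finset.mul_sum, Finset.sum_const, Finset.card_univ,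
    Fintype.card_fin, nsmul_eq_mul] at h2
  have h3 : ∑ i, ‖mix W st.z i - avg st.z‖ ^ 2 ≤ consensusErr st.z :=
    (sum_norm_mix_sub_avg_le hM hrow st.z).trans (mul_le_of_le_one_left (consensusErr_nonneg _)
      (pow_le_one₀ (mixingRate_nonneg W) hρ.le))
  rw [norm_move_sq] at h2
  have e1 : ∑ i, ‖st.z i - avg st.z‖ ^ 2 = consensusErr st.z := rfl
  have e2 : ∑ i, ‖st.dir i - avg st.dir‖ ^ 2 = consensusErr st.dir := rfl
  rw [e1, e2] at h2
  rw [one_div_mul_eq_div, div_le_iff₀ hM']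
  have e3 : 3 * (4 * (1 / (M : ℝ) * consensusErr st.z)
        + p.ηy ^ 2 * (1 / (M : ℝ) * consensusErr st.dir)
        + p.ηx ^ 2 * ‖(avg st.dir).fst‖ ^ 2 + p.ηy ^ 2 * ‖(avg st.dir).snd‖ ^ 2) * M
      = 12 * consensusErr st.z + 3 * p.ηy ^ 2 * consensusErr st.dir
        + M * (3 * (p.ηx ^ 2 * ‖(avg st.dir).fst‖ ^ 2 + p.ηy ^ 2 * ‖(avg st.dir).snd‖ ^ 2)) := by
    field_simp
    ring
  rw [e3]
  linarith

end Pathwise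

/-! ### One step of inexact descent-ascent: value and best-response gap -/

section Descent

variable {d m : ℕ}

/-- The squared distance `‖y*(x) - y‖²` of `z = (x, y)` to the best response. -/
def gapSq (F : Pt d m → ℝ) (z : Pt d m) : ℝ := ‖argmax F z.fst - z.snd‖ ^ 2

theorem norm_fst_sq_le_sub (a b : Pt d m) : ‖a.fst - b.fst‖ ^ 2 ≤ ‖a - b‖ ^ 2 :=
  pow_le_pow_left₀ (norm_nonneg _) (norm_fst_le (a - b)) 2

theorem norm_snd_sq_le_sub (a b : Pt d m) : ‖a.snd - b.snd‖ ^ 2 ≤ ‖a - b‖ ^ 2 :=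
  pow_le_pow_left₀ (norm_nonneg _) (norm_snd_le (a - b)) 2

namespace IsSaddle

variable {F : Pt d m → ℝ} {L μ : ℝ} (hF : IsSaddle F L μ)
include hF

theorem norm_gradient_argmax_sub_sq_le (z : Pt d m) :
    ‖gradient F (pt z.fst (argmax F z.fst)) - gradient F z‖ ^ 2 ≤ L ^ 2 * gapSq F z := by
  rw [gapSq, ← mul_pow]
  exact pow_le_pow_left₀ (norm_nonneg _) (hF.norm_gradient_fst_sub_le z.fst _ z.snd) 2

/-- The y-gradient vanishes at the best response, so at `z` it is at most L times the distance to
it. -/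
theorem norm_snd_sq_le (z v : Pt d m) :
    ‖v.snd‖ ^ 2 ≤ 2 * L ^ 2 * gapSq F z + 2 * ‖v - gradient F z‖ ^ 2 := by
  have h1 := hF.norm_gradient_argmax_sub_sq_le z
  have h2 := norm_snd_sq_le_sub (gradient F (pt z.fst (argmax F z.fst))) (gradient F z)
  rw [hF.gradient_argmax_snd, zero_sub, norm_neg] at h2
  have h3 := norm_snd_sq_le_sub v (gradient F z)
  have h4 := norm_add_sq_le_two (v.snd - (gradient F z).snd) (gradient F z).snd
  rw [sub_add_cancel] at h4
  linarith

/-- Polarisation turns the inner product of the true gradient with the direction into half of ‖∇Φ‖²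
plus half of ‖v_x‖² minus half of the squared discrepancy. The quadratic remainder uses at most half
of the gain in ‖v_x‖²; the other half is kept, and later absorbs both the drift of the best response
and the displacements. -/
theorem max_move_le {p : Params} (hx : 0 ≤ p.ηx)
    (hK : L * (1 + (L / μ) ^ 2) * p.ηx ≤ 1 / 4) (z v : Pt d m) :
    F (pt (z + move p v).fst (argmax F (z + move p v).fst))
      ≤ F (pt z.fst (argmax F z.fst))
        - p.ηx / 2 * ‖(gradient F (pt z.fst (argmax F z.fst))).fst‖ ^ 2
        - p.ηx / 4 * ‖v.fst‖ ^ 2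
        + p.ηx * (L ^ 2 * gapSq F z + ‖v - gradient F z‖ ^ 2) := by
  have h1 := (abs_le.1 (hF.abs_max_sub_sub_inner_le z.fst (z + move p v).fst)).2
  set G := gradient F (pt z.fst (argmax F z.fst)) with hG
  have e : (z + move p v).fst - z.fst = -(p.ηx • v.fst) := by
    simp
  rw [e, norm_neg, inner_neg_right, inner_smul_right, norm_smul, Real.norm_eq_abs, mul_pow,
    sq_abs] at h1
  have h2 : 2 * inner ℝ G.fst v.fst = ‖G.fst‖ ^ 2 + ‖v.fst‖ ^ 2 - ‖G.fst - v.fst‖ ^ 2 := by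
    rw [norm_sub_sq_real]; ring
  have h3 : ‖G.fst - v.fst‖ ^ 2 ≤ 2 * (L ^ 2 * gapSq F z) + 2 * ‖v - gradient F z‖ ^ 2 := by
    have a1 := hF.norm_gradient_argmax_sub_sq_le z
    have a2 := norm_fst_sq_le_sub G (gradient F z)
    have a3 := norm_fst_sq_le_sub v (gradient F z)
    have a4 := norm_sub_sq_le_two (G.fst - (gradient F z).fst) (v.fst - (gradient F z).fst)
    rw [sub_sub_sub_cancel_right] at a4
    linarith
  have h4 : L * (1 + (L / μ) ^ 2) * (p.ηx ^ 2 * ‖v.fst‖ ^ 2) ≤ 1 / 4 * (p.ηx * ‖v.fst‖ ^ 2) := by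
    have := mul_le_mul_of_nonneg_right hK (mul_nonneg hx (sq_nonneg ‖v.fst‖))
    linarith
  have h5 := mul_le_mul_of_nonneg_left h3 hx
  have h6 : p.ηx * (2 * inner ℝ G.fst v.fst)
      = p.ηx * (‖G.fst‖ ^ 2 + ‖v.fst‖ ^ 2 - ‖G.fst - v.fst‖ ^ 2) := by rw [h2]
  linarith

/-- The new offset from the best response is an exact ascent step at fixed x, which contracts, plus
a perturbation made of the gradient error and the shift of the best response. Young's inequality
spends half of the contraction on the perturbation. -/
theorem gapSq_move_le {p : Params} (hy : 0 < p.ηy) (h1 : p.ηy * L ^ 2 ≤ μ) (h2 : p.ηy * μ ≤ 1)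
    (z v : Pt d m) :
    gapSq F (z + move p v) ≤ (1 - p.ηy * μ / 2) * gapSq F z
      + 6 / (p.ηy * μ) * (p.ηy ^ 2 * ‖v - gradient F z‖ ^ 2
        + (L / μ) ^ 2 * p.ηx ^ 2 * ‖v.fst‖ ^ 2) := by
  have hμ := hF.μ_pos
  have hημ : 0 < p.ηy * μ := mul_pos hy hμ
  set a := argmax F z.fst with ha
  set a' := argmax F (z + move p v).fst with ha'
  set G := gradient F z with hG
  -- Expanding the square gives the factor 1 - 2 ηy μ + ηy² L², and ηy L² ≤ μ.
  have b1 : ‖z.snd - a + p.ηy • G.snd‖ ^ 2 ≤ (1 - p.ηy * μ) * gapSq F z := by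
    have c1 := hF.monotone z.fst z.snd a
    rw [ha, hF.gradient_argmax_snd, sub_zero, ← ha, pt_fst_snd] at c1
    have c2 := hF.norm_gradient_argmax_sub_sq_le z
    have c3 := norm_snd_sq_le_sub (gradient F (pt z.fst a)) G
    rw [ha, hF.gradient_argmax_snd, zero_sub, norm_neg, ← ha] at c3
    have c4 : gapSq F z = ‖z.snd - a‖ ^ 2 := by rw [gapSq, norm_sub_rev]
    have c5 : ‖G.snd‖ ^ 2 ≤ L ^ 2 * ‖z.snd - a‖ ^ 2 := by rw [← c4]; exact c3.trans c2
    rw [norm_add_sq_real, inner_smul_right, norm_smul, Real.norm_eq_abs, mul_pow, sq_abs, c4,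
      real_inner_comm]
    have c6 := mul_le_mul_of_nonneg_left c1 hy.le
    have c7 := mul_le_mul_of_nonneg_left c5 (sq_nonneg p.ηy)
    have c8 := mul_le_mul_of_nonneg_right h1 (mul_nonneg hy.le (sq_nonneg ‖z.snd - a‖))
    linarith
  have b2 : ‖p.ηy • (v.snd - G.snd) - (a' - a)‖ ^ 2 ≤ 2 * (p.ηy ^ 2 * ‖v - G‖ ^ 2
        + (L / μ) ^ 2 * p.ηx ^ 2 * ‖v.fst‖ ^ 2) := by
    have c1 := norm_sub_sq_le_two (p.ηy • (v.snd - G.snd)) (a' - a)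
    rw [norm_smul, Real.norm_eq_abs, mul_pow, sq_abs] at c1
    have c2 := mul_le_mul_of_nonneg_left (norm_snd_sq_le_sub v G) (sq_nonneg p.ηy)
    have c3 := pow_le_pow_left₀ (norm_nonneg _)
      (hF.norm_argmax_sub_le (z + move p v).fst z.fst) 2
    have e : (z + move p v).fst - z.fst = -(p.ηx • v.fst) := by simp
    rw [e, norm_neg, norm_smul, Real.norm_eq_abs, mul_pow, mul_pow, sq_abs] at c3
    linarith
  have e : gapSq F (z + move p v)
      = ‖(z.snd - a + p.ηy • G.snd) + (p.ηy • (v.snd - G.snd) - (a' - a))‖ ^ 2 := by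
    rw [gapSq, norm_sub_rev]
    congr 2
    rw [smul_sub, WithLp.add_snd, move_snd]
    abel
  have hθ : 0 < p.ηy * μ / 2 := by positivity
  rw [e]
  refine (norm_add_sq_le_young hθ _ _).trans ?_
  have hg0 : 0 ≤ gapSq F z := sq_nonneg _
  -- With θ = ηy μ / 2: (1 + θ)(1 - 2θ) ≤ 1 - θ.
  have f1 : (1 + p.ηy * μ / 2) * ‖z.snd - a + p.ηy • G.snd‖ ^ 2
      ≤ (1 - p.ηy * μ / 2) * gapSq F z := by
    refine (mul_le_mul_of_nonneg_left b1 (by positivity)).trans ?_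
    nlinarith [mul_nonneg (sq_nonneg (p.ηy * μ)) hg0]
  have f2 : 1 + 1 / (p.ηy * μ / 2) ≤ 3 / (p.ηy * μ) := by
    rw [← sub_nonneg]
    have : 3 / (p.ηy * μ) - (1 + 1 / (p.ηy * μ / 2)) = (1 - p.ηy * μ) / (p.ηy * μ) := by
      field_simp; ring
    rw [this]
    exact div_nonneg (by linarith) hημ.le
  have f3 := mul_le_mul f2 b2 (sq_nonneg _) (by positivity)
  have f4 : 3 / (p.ηy * μ) * (2 * (p.ηy ^ 2 * ‖v - G‖ ^ 2
        + (L / μ) ^ 2 * p.ηx ^ 2 * ‖v.fst‖ ^ 2)) = 6 / (p.ηy * μ) * (p.ηy ^ 2 * ‖v - G‖ ^ 2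
        + (L / μ) ^ 2 * p.ηx ^ 2 * ‖v.fst‖ ^ 2) := by ring
  linarith

end IsSaddle

end Descent

/-! ### Solving the summed system of inequalities -/

section RealAlgebra

/-- Here `g` is the spectral gap 1 - ρ, and 5120 = (32√5)² comes from the step-size condition. The
tracking error is eliminated first: η² L² Cd is smaller than the sources by a factor g², which pays
for the two divisions by g in the bound on Cz. The condition `k2` on η alone serves the initial term
d₀, where the factor L² has to survive. -/
theorem consensus_sum_bound {L g η Cz Cd z₀ d₀ S : ℝ} (hg : 0 < g) (hg1 : g ≤ 1)
    (k1 : η ^ 2 * L ^ 2 ≤ g ^ 4 / 5120) (k2 : η ^ 2 ≤ g ^ 4 / 5120)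
    (hz₀ : 0 ≤ z₀) (hd₀ : 0 ≤ d₀) (hS : 0 ≤ S)
    (h3 : g * Cz ≤ z₀ + 2 * η ^ 2 / g * Cd) (h4 : g * Cd ≤ d₀ + 2 / g * S) :
    L ^ 2 * η ^ 2 * Cd ≤ L ^ 2 * (z₀ + d₀) / g / 5120 + S / 2560 ∧
    L ^ 2 * Cz ≤ L ^ 2 * (z₀ + d₀) / g + 2 * (L ^ 2 * (z₀ + d₀) / g / 5120 + S / 2560) := by
  have hR0 : 0 ≤ L ^ 2 * (z₀ + d₀) / g / 5120 + S / 2560 := by positivity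
  have a4 : L ^ 2 * η ^ 2 * Cd ≤ g ^ 2 * (L ^ 2 * (z₀ + d₀) / g / 5120 + S / 2560) := by
    have b1 : Cd ≤ (d₀ + 2 / g * S) / g := by
      rw [le_div_iff₀ hg]; linarith
    have b2 : L ^ 2 * η ^ 2 * Cd
        ≤ L ^ 2 * η ^ 2 * (d₀ / g) + η ^ 2 * L ^ 2 * (2 / g ^ 2 * S) := by
      refine (mul_le_mul_of_nonneg_left b1 (by positivity)).trans (le_of_eq ?_)
      field_simp
    have b3 : L ^ 2 * η ^ 2 * (d₀ / g) ≤ g ^ 2 * (L ^ 2 * (z₀ + d₀) / g / 5120) := by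
      have c2 : g ^ 4 ≤ g ^ 2 := pow_le_pow_of_le_one hg.le hg1 (by norm_num)
      have c1 : L ^ 2 * η ^ 2 * (d₀ / g) ≤ L ^ 2 * (g ^ 2 / 5120) * ((z₀ + d₀) / g) := by
        have : η ^ 2 ≤ g ^ 2 / 5120 := by linarith
        gcongr; linarith
      refine c1.trans (le_of_eq ?_)
      ring
    have b4 : η ^ 2 * L ^ 2 * (2 / g ^ 2 * S) ≤ g ^ 4 / 5120 * (2 / g ^ 2 * S) := by gcongr
    have b5 : g ^ 4 / 5120 * (2 / g ^ 2 * S) = g ^ 2 * (S / 2560) := by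
      field_simp; ring
    linarith
  refine ⟨a4.trans (mul_le_of_le_one_left hR0 (pow_le_one₀ hg.le hg1)), ?_⟩
  have b1 : L ^ 2 * (g * Cz) ≤ L ^ 2 * z₀ + 2 / g * (L ^ 2 * η ^ 2 * Cd) := by
    refine (mul_le_mul_of_nonneg_left h3 (sq_nonneg L)).trans (le_of_eq ?_)
    ring
  have b2 := mul_le_mul_of_nonneg_left a4 (by positivity : 0 ≤ 2 / g)
  have b3 : L ^ 2 * Cz ≤ (L ^ 2 * z₀ + 2 / g * (g ^ 2 *
      (L ^ 2 * (z₀ + d₀) / g / 5120 + S / 2560))) / g := by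
    rw [le_div_iff₀ hg]; linarith
  have b4 : ∀ R, (L ^ 2 * z₀ + 2 / g * (g ^ 2 * R)) / g = L ^ 2 * z₀ / g + 2 * R := by
    intro R; field_simp
  rw [b4] at b3
  have b5 : L ^ 2 * z₀ / g ≤ L ^ 2 * (z₀ + d₀) / g := by gcongr; linarith
  linarith

/-- Consequence of the summed recursions. -/
theorem sum_bound {L κ g ηx ηy G X Y Cz Cd D Ev s δ δ₀ z₀ d₀ Φ : ℝ}
    (hL : 0 < L) (hκ : 1 ≤ κ) (hg : 0 < g) (hg1 : g ≤ 1) (hηx : 0 < ηx) (hηy : 0 < ηy)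
    (k1 : ηy ^ 2 * L ^ 2 ≤ g ^ 4 / 5120) (k2 : ηy ^ 2 ≤ g ^ 4 / 5120)
    (k3 : κ ^ 2 * (ηy ^ 2 * L ^ 2) ≤ 1 / 5120) (k4 : 64 * κ ^ 2 * ηx ≤ ηy)
    (hG : 0 ≤ G) (hX : 0 ≤ X) (hD : 0 ≤ D) (hs : 0 ≤ s) (hδ : 0 ≤ δ)
    (hδ₀ : 0 ≤ δ₀) (hz₀ : 0 ≤ z₀) (hd₀ : 0 ≤ d₀) (hCz : 0 ≤ Cz) (hEv : 0 ≤ Ev)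
    (h1 : Ev ≤ s + L ^ 2 * D)
    (h2 : D ≤ 3 * (4 * Cz + ηy ^ 2 * Cd + ηx ^ 2 * X + ηy ^ 2 * Y))
    (h3 : g * Cz ≤ z₀ + 2 * ηy ^ 2 / g * Cd)
    (h4 : g * Cd ≤ d₀ + 2 / g * (s + 2 * L ^ 2 * D + 2 * Ev))
    (h5 : ηx / 2 * G + ηx / 4 * X ≤ Φ + ηx * (L ^ 2 * δ + (2 * L ^ 2 * Cz + 2 * Ev)))
    (h6 : ηy * (L / κ) / 2 * δ ≤ δ₀ + 6 / (ηy * (L / κ)) *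
      (ηy ^ 2 * (2 * L ^ 2 * Cz + 2 * Ev) + κ ^ 2 * ηx ^ 2 * X))
    (h7 : Y ≤ 2 * L ^ 2 * δ + 2 * (2 * L ^ 2 * Cz + 2 * Ev)) :
    ηx / 50 * G ≤ Φ + ηx * (18 * L * κ / ηy * δ₀ + 9772 * L ^ 2 * κ ^ 2 / g * (z₀ + d₀)
      + 323 * κ ^ 2 * s) := by
  have hκ0 : 0 < κ := by linarith
  have hk2 : 1 ≤ κ ^ 2 := one_le_pow₀ hκ
  -- The estimator error is eliminated from the source of the tracking recursion by `h1`: s + 2L²D +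
  -- 2Ev ≤ 3s + 4L²D.
  obtain ⟨q1, p1⟩ := consensus_sum_bound (L := L) (S := 3 * s + 4 * (L ^ 2 * D)) hg hg1 k1 k2
    hz₀ hd₀ (by positivity) h3 (h4.trans (by
      have : 2 / g * (s + 2 * L ^ 2 * D + 2 * Ev) ≤ 2 / g * (3 * s + 4 * (L ^ 2 * D)) := by
        refine mul_le_mul_of_nonneg_left ?_ (by positivity)
        linarith
      linarith))
  have q2 := mul_le_mul_of_nonneg_left q1 (sq_nonneg κ)
  have p2 := mul_le_mul_of_nonneg_left p1 (sq_nonneg κ)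
  -- the displacements
  have hB0 : 0 ≤ 2 * L ^ 2 * Cz + 2 * Ev := by positivity
  have hBk : 2 * L ^ 2 * Cz + 2 * Ev ≤ κ ^ 2 * (2 * L ^ 2 * Cz + 2 * Ev) :=
    le_mul_of_one_le_left hB0 hk2
  have u1 : κ ^ 2 * (L ^ 2 * D) ≤ 12 * (κ ^ 2 * (L ^ 2 * Cz)) + 3 * (κ ^ 2 * (L ^ 2 * ηy ^ 2 * Cd))
      + 3 / 5120 * X + 3 / 5120 * (2 * (L ^ 2 * δ)
        + 2 * (κ ^ 2 * (2 * L ^ 2 * Cz + 2 * Ev))) := by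
    have hxy : ηx ≤ ηy := by nlinarith
    have b1 : κ ^ 2 * (ηx ^ 2 * L ^ 2) * X ≤ 1 / 5120 * X := by
      refine mul_le_mul_of_nonneg_right (le_trans ?_ k3) hX
      gcongr
    have b2 : κ ^ 2 * (ηy ^ 2 * L ^ 2) * Y
        ≤ 1 / 5120 * (2 * L ^ 2 * δ + 2 * (2 * L ^ 2 * Cz + 2 * Ev)) :=
      (mul_le_mul_of_nonneg_left h7 (by positivity)).trans
        (mul_le_mul_of_nonneg_right k3 (by positivity))
    have b3 := mul_le_mul_of_nonneg_left h2 (by positivity : 0 ≤ κ ^ 2 * L ^ 2)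
    linarith
  -- the best-response gap
  have v1 : L ^ 2 * δ ≤ 2 * (L * κ / ηy * δ₀) + 12 * (κ ^ 2 * (2 * L ^ 2 * Cz + 2 * Ev))
      + 1 / 300 * X := by
    -- The multiplier inverts the coefficient ηy (L / κ) / 2 of δ and supplies the factor L².
    have b0 := mul_le_mul_of_nonneg_left h6 (by positivity : 0 ≤ 2 * L * κ / ηy)
    have e1 : 2 * L * κ / ηy * (ηy * (L / κ) / 2 * δ) = L ^ 2 * δ := by field_simp
    have e2 : ∀ B, 2 * L * κ / ηy * (δ₀ + 6 / (ηy * (L / κ)) * (ηy ^ 2 * B + κ ^ 2 * ηx ^ 2 * X))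
        = 2 * (L * κ / ηy * δ₀) + 12 * (κ ^ 2 * B) + 12 * (κ ^ 2 * ηx / ηy) ^ 2 * X := by
      intro B; field_simp; ring
    rw [e1, e2] at b0
    -- The timescale separation: 12 · (1 / 64)² ≤ 1 / 300, so the drift of the best response takes
    -- only a small part of the reserve X / 4.
    have b1 : κ ^ 2 * ηx / ηy ≤ 1 / 64 := by
      rw [div_le_iff₀ hηy]; linarith
    have b2 : (κ ^ 2 * ηx / ηy) ^ 2 ≤ (1 / 64) ^ 2 := pow_le_pow_left₀ (by positivity) b1 2
    have b3 := mul_le_mul_of_nonneg_right b2 hX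
    linarith
  have e1 := mul_le_mul_of_nonneg_left h1 (sq_nonneg κ)
  have n1 : 0 ≤ κ ^ 2 * s := by positivity
  have n2 : 0 ≤ κ ^ 2 * (L ^ 2 * (z₀ + d₀) / g) := by positivity
  have n3 : 0 ≤ L * κ / ηy * δ₀ := by positivity
  -- After scaling by κ² the system is linear in κ²L²Cz, κ²L²ηy²Cd, κ²L²D, κ²Ev, L²δ and X. Every
  -- cycle of bounds has a small total factor, so it can be solved by a nonnegative combination. The
  -- X / 4 allowed here is exactly what the descent inequality `h5` pays for.
  have fin : L ^ 2 * δ + (2 * L ^ 2 * Cz + 2 * Ev) ≤ X / 4 + (18 * L * κ / ηy * δ₀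
      + 9772 * L ^ 2 * κ ^ 2 / g * (z₀ + d₀) + 323 * κ ^ 2 * s) := by
    have e2 : 18 * L * κ / ηy * δ₀ = 18 * (L * κ / ηy * δ₀) := by ring
    have e3 : 9772 * L ^ 2 * κ ^ 2 / g * (z₀ + d₀)
        = 9772 * (κ ^ 2 * (L ^ 2 * (z₀ + d₀) / g)) := by ring
    rw [e2, e3]
    clear e2 e3 h1 h2 h3 h4 h5 h6 h7 k1 k2 k3 k4
    generalize L ^ 2 * (z₀ + d₀) / g = Λ at *
    generalize L * κ / ηy * δ₀ = w at *
    linarith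
  have f1 := mul_le_mul_of_nonneg_left fin hηx.le
  have f2 : 0 ≤ ηx * G := by positivity
  linarith

end RealAlgebra

/-! ### Independence, and the second moment of a batch average -/

section Probability

variable {Ω : Type*} [MeasurableSpace Ω] {Pr : Measure Ω}

theorem integral_add_add {a b c : Ω → ℝ} (ha : Integrable a Pr) (hb : Integrable b Pr)
    (hc : Integrable c Pr) :
    ∫ ω, (a ω + b ω + c ω) ∂Pr = ∫ ω, a ω ∂Pr + ∫ ω, b ω ∂Pr + ∫ ω, c ω ∂Pr := by
  rw [← integral_add ha hb]
  exact integral_add (ha.add hb) hc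

/-- Integrating out the second of two independent variables. -/
theorem integrable_and_integral_le_of_indepFun [IsProbabilityMeasure Pr] {α β : Type*}
    [MeasurableSpace α] [MeasurableSpace β] {X : Ω → α} {Y : Ω → β} (hX : Measurable X)
    (hY : Measurable Y) (hXY : IndepFun X Y Pr) {F : α → β → ℝ}
    (hF : Measurable (Function.uncurry F)) (hF0 : ∀ x y, 0 ≤ F x y) {B : α → ℝ}
    (hB : ∀ x, Integrable (fun ω => F x (Y ω)) Pr ∧ ∫ ω, F x (Y ω) ∂Pr ≤ B x)
    (hBi : Integrable (fun ω => B (X ω)) Pr) :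
    Integrable (fun ω => F (X ω) (Y ω)) Pr ∧
      ∫ ω, F (X ω) (Y ω) ∂Pr ≤ ∫ ω, B (X ω) ∂Pr := by
  have hB0 : ∀ x, 0 ≤ B x := fun x => (integral_nonneg fun ω => hF0 x (Y ω)).trans (hB x).2
  have hmeas : Measurable fun ω => F (X ω) (Y ω) := hF.comp (hX.prodMk hY)
  have key : ∫⁻ ω, ENNReal.ofReal (F (X ω) (Y ω)) ∂Pr ≤ ∫⁻ ω, ENNReal.ofReal (B (X ω)) ∂Pr := by
    have h1 := (indepFun_iff_map_prod_eq_prod_map_map hX.aemeasurable hY.aemeasurable).1 hXY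
    have hm : Measurable fun z : α × β => ENNReal.ofReal (F z.1 z.2) :=
      ENNReal.measurable_ofReal.comp hF
    have : IsProbabilityMeasure (Pr.map X) := Measure.isProbabilityMeasure_map hX.aemeasurable
    have : IsProbabilityMeasure (Pr.map Y) := Measure.isProbabilityMeasure_map hY.aemeasurable
    calc ∫⁻ ω, ENNReal.ofReal (F (X ω) (Y ω)) ∂Pr
        = ∫⁻ z, ENNReal.ofReal (F z.1 z.2) ∂(Pr.map fun ω => (X ω, Y ω)) :=
          (lintegral_map hm (hX.prodMk hY)).symm
      _ = ∫⁻ x, ∫⁻ y, ENNReal.ofReal (F x y) ∂(Pr.map Y) ∂(Pr.map X) := by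
          rw [h1, lintegral_prod _ hm.aemeasurable]
      _ = ∫⁻ ω, ∫⁻ y, ENNReal.ofReal (F (X ω) y) ∂(Pr.map Y) ∂Pr :=
          lintegral_map hm.lintegral_prod_right' hX
      _ ≤ _ := by
          refine lintegral_mono fun ω => ?_
          rw [lintegral_map (f := fun y => ENNReal.ofReal (F (X ω) y))
            (hm.comp measurable_prodMk_left) hY,
            ← ofReal_integral_eq_lintegral_ofReal (hB (X ω)).1
              (Filter.Eventually.of_forall fun _ => hF0 _ _)]
          exact ENNReal.ofReal_le_ofReal (hB (X ω)).2
  have hfin : ∫⁻ ω, ENNReal.ofReal (B (X ω)) ∂Pr < ⊤ := by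
    rw [← ofReal_integral_eq_lintegral_ofReal hBi (Filter.Eventually.of_forall fun _ => hB0 _)]
    exact ENNReal.ofReal_lt_top
  have hint : Integrable (fun ω => F (X ω) (Y ω)) Pr := by
    refine ⟨hmeas.aestronglyMeasurable, ?_⟩
    rw [hasFiniteIntegral_iff_ofReal (Filter.Eventually.of_forall fun _ => hF0 _ _)]
    exact key.trans_lt hfin
  refine ⟨hint, ?_⟩
  rw [← ofReal_integral_eq_lintegral_ofReal hBi (Filter.Eventually.of_forall fun _ => hB0 _),
    ← ofReal_integral_eq_lintegral_ofReal hint (Filter.Eventually.of_forall fun _ => hF0 _ _)]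
    at key
  exact (ENNReal.ofReal_le_ofReal_iff (integral_nonneg fun _ => hB0 _)).1 key

variable {E : Type*} [NormedAddCommGroup E] [InnerProductSpace ℝ E]

theorem integral_norm_sub_integral_sq [CompleteSpace E] [IsProbabilityMeasure Pr] {X : Ω → E}
    (hX : MemLp X 2 Pr) :
    ∫ ω, ‖X ω - ∫ ω', X ω' ∂Pr‖ ^ 2 ∂Pr = ∫ ω, ‖X ω‖ ^ 2 ∂Pr - ‖∫ ω, X ω ∂Pr‖ ^ 2 := by
  have h1 : Integrable X Pr := hX.integrable (by norm_num)
  have h2 : Integrable (fun ω => ‖X ω‖ ^ 2) Pr :=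
    (memLp_two_iff_integrable_sq_norm hX.1).1 hX
  set a := ∫ ω, X ω ∂Pr with ha
  have e : ∀ ω, ‖X ω - a‖ ^ 2 = ‖X ω‖ ^ 2 + -2 * inner ℝ a (X ω) + ‖a‖ ^ 2 := fun ω => by
    rw [norm_sub_sq_real, real_inner_comm]; ring
  simp only [e]
  have h3 : Integrable (fun ω => -2 * inner ℝ a (X ω)) Pr := (h1.const_inner a).const_mul (-2)
  rw [integral_add_add h2 h3 (integrable_const _), integral_const_mul,
    integral_inner h1, ← ha, real_inner_self_eq_norm_sq]
  simp
  ring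

variable [CompleteSpace E] [MeasurableSpace E] [BorelSpace E]

/-- Induction on the number of terms: the inner product of two independent centred vectors
integrates to zero, so second moments add. -/
theorem memLp_and_integral_sum_of_iIndepFun [IsProbabilityMeasure Pr] {U : ℕ → Ω → E}
    (hU : iIndepFun U Pr) (hL : ∀ s, MemLp (U s) 2 Pr) (h0 : ∀ s, ∫ ω, U s ω ∂Pr = 0) {V : ℝ}
    (hV : ∀ s, ∫ ω, ‖U s ω‖ ^ 2 ∂Pr ≤ V) (n : ℕ) :
    MemLp (fun ω => ∑ s ∈ Finset.range n, U s ω) 2 Pr ∧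
      ∫ ω, ∑ s ∈ Finset.range n, U s ω ∂Pr = 0 ∧
      ∫ ω, ‖∑ s ∈ Finset.range n, U s ω‖ ^ 2 ∂Pr ≤ n * V := by
  have hI : ∀ s, Integrable (U s) Pr := fun s => (hL s).integrable (by norm_num)
  have hM : ∀ n, MemLp (fun ω => ∑ s ∈ Finset.range n, U s ω) 2 Pr := fun n =>
    memLp_finsetSum _ fun s _ => hL s
  refine ⟨hM n, ?_, ?_⟩
  · rw [integral_finsetSum _ fun s _ => hI s]
    exact Finset.sum_eq_zero fun s _ => h0 s
  · induction n with
    | zero => simp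
    | succ n ih =>
      have hB : ∀ s ∈ Finset.range n, Integrable (fun ω => inner ℝ (U s ω) (U n ω)) Pr ∧
          ∫ ω, inner ℝ (U s ω) (U n ω) ∂Pr = 0 := by
        intro s hs
        have hi : IndepFun (U s) (U n) Pr := hU.indepFun (Finset.mem_range.1 hs).ne
        refine ⟨hi.integrable_bilin (hI s) (hI n) (innerSL ℝ), ?_⟩
        refine (hi.integral_bilin (hI s) (hI n) (innerSL ℝ)).trans ?_
        rw [h0 n, map_zero]
      have e : ∀ ω, ‖∑ s ∈ Finset.range (n + 1), U s ω‖ ^ 2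
          = ‖∑ s ∈ Finset.range n, U s ω‖ ^ 2
            + 2 * ∑ s ∈ Finset.range n, inner ℝ (U s ω) (U n ω) + ‖U n ω‖ ^ 2 := fun ω => by
        rw [Finset.sum_range_succ, norm_add_sq_real, sum_inner]
      simp only [e]
      have i1 := (memLp_two_iff_integrable_sq_norm (hM n).1).1 (hM n)
      have i2 := (memLp_two_iff_integrable_sq_norm (hL n).1).1 (hL n)
      have i3 : Integrable (fun ω => 2 * ∑ s ∈ Finset.range n, inner ℝ (U s ω) (U n ω)) Pr :=
        (integrable_finsetSum _ fun s hs => (hB s hs).1).const_mul 2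
      rw [integral_add_add i1 i3 i2, integral_const_mul,
        integral_finsetSum _ fun s hs => (hB s hs).1, Finset.sum_eq_zero fun s hs => (hB s hs).2]
      have := hV n
      push_cast
      linarith

theorem integral_norm_add_batch_sq_le [IsProbabilityMeasure Pr] {Ξ : Type*} [MeasurableSpace Ξ]
    {Q : Measure Ξ} {U : ℕ → Ω → Ξ} (hU : iIndepFun U Pr) (hUm : ∀ s, Measurable (U s))
    (hQ : ∀ s, Pr.map (U s) = Q) {φ : Ξ → E} (hφ : Measurable φ) (hφL : MemLp φ 2 Q)
    (hφ0 : ∫ x, φ x ∂Q = 0) {V : ℝ} (hV : ∫ x, ‖φ x‖ ^ 2 ∂Q ≤ V) {S : ℕ} (hS : 1 ≤ S) (a : E) :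
    Integrable (fun ω => ‖a + (1 / (S : ℝ)) • ∑ s ∈ Finset.range S, φ (U s ω)‖ ^ 2) Pr ∧
      ∫ ω, ‖a + (1 / (S : ℝ)) • ∑ s ∈ Finset.range S, φ (U s ω)‖ ^ 2 ∂Pr ≤ ‖a‖ ^ 2 + V / S := by
  have hS' : (0 : ℝ) < S := by exact_mod_cast hS
  have hL : ∀ s, MemLp (fun ω => φ (U s ω)) 2 Pr := fun s => by
    have := hQ s ▸ hφL
    exact this.comp_of_map (hUm s).aemeasurable
  have h0 : ∀ s, ∫ ω, φ (U s ω) ∂Pr = 0 := fun s => by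
    rw [← hφ0, ← hQ s, integral_map (hUm s).aemeasurable]
    rw [hQ s]; exact hφL.1
  have hV' : ∀ s, ∫ ω, ‖φ (U s ω)‖ ^ 2 ∂Pr ≤ V := fun s => by
    refine le_trans (le_of_eq ?_) hV
    rw [← hQ s, integral_map (hUm s).aemeasurable (f := fun x => ‖φ x‖ ^ 2)]
    rw [hQ s]; exact hφL.1.norm.pow 2
  obtain ⟨b1, b2, b3⟩ := memLp_and_integral_sum_of_iIndepFun (U := fun s ω => φ (U s ω))
    (hU.comp (fun _ => φ) fun _ => hφ) hL h0 hV' S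
  have i1 : Integrable (fun ω => ∑ s ∈ Finset.range S, φ (U s ω)) Pr := b1.integrable (by norm_num)
  have i2 := (memLp_two_iff_integrable_sq_norm b1.1).1 b1
  have e : ∀ ω, ‖a + (1 / (S : ℝ)) • ∑ s ∈ Finset.range S, φ (U s ω)‖ ^ 2
      = ‖a‖ ^ 2 + 2 * (1 / (S : ℝ)) * inner ℝ a (∑ s ∈ Finset.range S, φ (U s ω))
        + (1 / (S : ℝ)) ^ 2 * ‖∑ s ∈ Finset.range S, φ (U s ω)‖ ^ 2 := fun ω => by
    rw [norm_add_sq_real, inner_smul_right, norm_smul, mul_pow, Real.norm_eq_abs, sq_abs]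
    ring
  simp only [e]
  have i3 := (i1.const_inner (𝕜 := ℝ) a).const_mul (2 * (1 / (S : ℝ)))
  have i4 := i2.const_mul ((1 / (S : ℝ)) ^ 2)
  have i5 : Integrable (fun _ : Ω => ‖a‖ ^ 2) Pr := integrable_const _
  refine ⟨(i5.add i3).add i4, ?_⟩
  rw [integral_add_add i5 i3 i4, integral_const_mul, integral_const_mul,
    integral_inner i1, b2, inner_zero_right, integral_const]
  have h3 := mul_le_mul_of_nonneg_left b3 (sq_nonneg (1 / (S : ℝ)))
  have h4 : (1 / (S : ℝ)) ^ 2 * (S * V) = V / S := by field_simp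
  simp only [probReal_univ, smul_eq_mul]
  linarith

end Probability

/-! ### Consequences of the oracle assumptions -/

section Oracle

variable {M d m : ℕ} {Ξ : Type*} [MeasurableSpace Ξ] {f : Fin M → Pt d m → ℝ}
  {g : Fin M → Pt d m → Ξ → Pt d m} {P : Fin M → Measure Ξ} {σ L : ℝ}

namespace IsOracle

variable (hg : IsOracle f g P σ L)
include hg

theorem measurable_right (i : Fin M) (z : Pt d m) : Measurable (g i z) :=
  (hg.measurable i).comp measurable_prodMk_left

theorem memLp_noise (i : Fin M) (z : Pt d m) :
    MemLp (fun s => g i z s - gradient (f i) z) 2 (P i) :=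
  (memLp_two_iff_integrable_sq_norm
    ((hg.measurable_right i z).sub_const _).aestronglyMeasurable).2 (hg.integrable_sq i z)

variable [∀ i, IsProbabilityMeasure (P i)]

theorem memLp (i : Fin M) (z : Pt d m) : MemLp (g i z) 2 (P i) := by
  have := (hg.memLp_noise i z).add (memLp_const (gradient (f i) z))
  simpa [Pi.add_def] using this

theorem memLp_sub (i : Fin M) (z z' : Pt d m) : MemLp (fun s => g i z s - g i z' s) 2 (P i) :=
  (hg.memLp i z).sub (hg.memLp i z')

omit [∀ i, IsProbabilityMeasure (P i)] in
theorem integral_sub (i : Fin M) (z z' : Pt d m) :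
    ∫ s, (g i z s - g i z' s) ∂(P i) = gradient (f i) z - gradient (f i) z' := by
  rw [MeasureTheory.integral_sub (hg.integrable i z) (hg.integrable i z'), hg.unbiased,
    hg.unbiased]

/-- Jensen's inequality: the gradient difference is the mean of the stochastic difference, and its
square is at most the second moment because a variance is nonnegative. Smoothness of the `f i` is
thus a consequence of the mean-squared Lipschitz oracle. -/
theorem gradient_lipschitz (hL : 0 ≤ L) (i : Fin M) (z z' : Pt d m) :
    ‖gradient (f i) z - gradient (f i) z'‖ ≤ L * ‖z - z'‖ := by
  have h1 := integral_norm_sub_integral_sq (hg.memLp_sub i z z')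
  have h2 : 0 ≤ ∫ s, ‖(g i z s - g i z' s) - ∫ s', (g i z s' - g i z' s') ∂(P i)‖ ^ 2 ∂(P i) :=
    integral_nonneg fun _ => sq_nonneg _
  rw [h1, hg.integral_sub] at h2
  have h3 := hg.lipschitz_sq i z z'
  rw [← sq_le_sq₀ (norm_nonneg _) (by positivity), mul_pow]
  linarith

theorem integral_noise_sub_le (i : Fin M) (z z' : Pt d m) :
    ∫ s, ‖(g i z s - g i z' s) - (gradient (f i) z - gradient (f i) z')‖ ^ 2 ∂(P i)
      ≤ L ^ 2 * ‖z - z'‖ ^ 2 := by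
  have h1 := integral_norm_sub_integral_sq (hg.memLp_sub i z z')
  rw [hg.integral_sub] at h1
  rw [h1]
  have := hg.lipschitz_sq i z z'
  have := sq_nonneg ‖gradient (f i) z - gradient (f i) z'‖
  linarith

end IsOracle

end Oracle

/-! ### The averaged objective inherits smoothness and strong concavity -/

section GeneralGradient

variable {E : Type*} [NormedAddCommGroup E] [InnerProductSpace ℝ E] [CompleteSpace E]

theorem hasDerivAt_line {h : E → ℝ} (hh : Differentiable ℝ h) (z w : E) :
    HasDerivAt (fun t : ℝ => h (z + t • w)) (inner ℝ (gradient h z) w) 0 := by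
  have h1 : HasDerivAt (fun t : ℝ => z + t • w) w 0 := by
    simpa using ((hasDerivAt_id (0 : ℝ)).smul_const w).const_add z
  have h2 : HasFDerivAt h (fderiv ℝ h z) (z + (0 : ℝ) • w) := by
    simpa using (hh z).hasFDerivAt
  rw [inner_gradient_left]
  exact h2.comp_hasDerivAt 0 h1

omit [CompleteSpace E] in
theorem differentiable_mean {M : ℕ} {f : Fin M → E → ℝ} (hf : ∀ i, Differentiable ℝ (f i)) :
    Differentiable ℝ fun z => (1 / (M : ℝ)) * ∑ i, f i z := by
  fun_prop

theorem gradient_mean {M : ℕ} {f : Fin M → E → ℝ} (hf : ∀ i, Differentiable ℝ (f i)) (z : E) :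
    gradient (fun z => (1 / (M : ℝ)) * ∑ i, f i z) z = avg fun i => gradient (f i) z := by
  refine HasGradientAt.gradient ?_
  rw [hasGradientAt_iff_hasFDerivAt]
  have h1 : HasFDerivAt (fun z => ∑ i, f i z) (∑ i, fderiv ℝ (f i) z) z :=
    HasFDerivAt.fun_sum fun i _ => (hf i z).hasFDerivAt
  have h2 := h1.const_mul (1 / (M : ℝ))
  have e : InnerProductSpace.toDual ℝ E (avg fun i => gradient (f i) z)
      = (1 / (M : ℝ)) • ∑ i, fderiv ℝ (f i) z := by
    simp [avg, gradient]
  rw [e]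
  exact h2

omit [CompleteSpace E] in
theorem norm_avg_le_of_le {M : ℕ} (hM : 0 < M) {u : Fin M → E} {C : ℝ} (h : ∀ i, ‖u i‖ ≤ C) :
    ‖avg u‖ ≤ C := by
  have hM' : (0 : ℝ) < M := by positivity
  rw [avg, norm_smul, Real.norm_eq_abs, abs_of_pos (by positivity), one_div_mul_eq_div,
    div_le_iff₀ hM']
  refine (norm_sum_le _ _).trans ((Finset.sum_le_sum fun i _ => h i).trans (le_of_eq ?_))
  simp [mul_comm]

end GeneralGradient

section Saddle

variable {M d m : ℕ} {f : Fin M → Pt d m → ℝ} {L μ : ℝ}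

theorem isSaddle_mean (hM : 0 < M) (hL : 0 < L) (hμ : 0 < μ) (hf : ∀ i, Differentiable ℝ (f i))
    (hconc : ∀ i x, StrongConcaveOn Set.univ μ fun y => f i (pt x y))
    (hLip : ∀ i z z', ‖gradient (f i) z - gradient (f i) z'‖ ≤ L * ‖z - z'‖) :
    IsSaddle (fun z => (1 / (M : ℝ)) * ∑ i, f i z) L μ where
  L_pos := hL
  μ_pos := hμ
  differentiable := differentiable_mean hf
  lipschitz z z' := by
    rw [gradient_mean hf, gradient_mean hf, ← avg_sub]
    exact norm_avg_le_of_le hM fun i => hLip i z z'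
  concave x y y' := by
    have hM' : (0 : ℝ) < M := by positivity
    have h1 : ∀ i, f i (pt x y') ≤ f i (pt x y)
        + inner ℝ (gradient (f i) (pt x y)) (pt 0 (y' - y)) - μ / 2 * ‖y' - y‖ ^ 2 := by
      intro i
      have hw := hasDerivAt_line (hf i) (pt x y) (pt 0 (y' - y))
      have e : ∀ t : ℝ, pt x y + t • pt 0 (y' - y) = pt x (y + t • (y' - y)) := fun t =>
        pt_ext (by simp) (by simp)
      simp only [e] at hw
      have e2 : inner ℝ (gradient (f i) (pt x y)) (pt 0 (y' - y))
          = inner ℝ (gradient (f i) (pt x y)).snd (y' - y) := by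
        rw [inner_pt]; simp
      rw [e2] at hw ⊢
      exact StrongConcaveOn.le_add_inner_sub (hconc i x) hw
    have h2 := Finset.sum_le_sum fun i (_ : i ∈ Finset.univ) => h1 i
    rw [Finset.sum_sub_distrib, Finset.sum_add_distrib, ← sum_inner, Finset.sum_const,
      Finset.card_univ, Fintype.card_fin, nsmul_eq_mul] at h2
    have h3 := mul_le_mul_of_nonneg_left h2 (by positivity : 0 ≤ 1 / (M : ℝ))
    have e3 : inner ℝ (gradient (fun z => (1 / (M : ℝ)) * ∑ i, f i z) (pt x y)).snd (y' - y)
        = 1 / (M : ℝ) * inner ℝ (∑ i, gradient (f i) (pt x y)) (pt 0 (y' - y)) := by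
      rw [gradient_mean hf, avg, inner_pt]
      simp only [WithLp.smul_snd, pt_snd, pt_fst, inner_zero_right, zero_add]
      rw [real_inner_smul_left]
    rw [e3]
    refine h3.trans (le_of_eq ?_)
    field_simp

end Saddle

/-! ### Measurability of the run and independence from future samples -/

section Measurability

theorem measurable_sum_smul {α E ι : Type*} [MeasurableSpace α] [NormedAddCommGroup E]
    [NormedSpace ℝ E] [MeasurableSpace E] [BorelSpace E] [SecondCountableTopology E] {s : Finset ι}
    {u : ι → α → E} (hu : ∀ i, Measurable (u i)) (w : ι → ℝ) :
    Measurable fun a => ∑ i ∈ s, w i • u i a := by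
  fun_prop

theorem measurable_smul_sum {α E ι : Type*} [MeasurableSpace α] [NormedAddCommGroup E]
    [NormedSpace ℝ E] [MeasurableSpace E] [BorelSpace E] [SecondCountableTopology E] {s : Finset ι}
    {u : ι → α → E} (hu : ∀ i, Measurable (u i)) (c : ℝ) :
    Measurable fun a => c • ∑ i ∈ s, u i a := by
  fun_prop

theorem memLp_sum_smul {α E ι : Type*} [MeasurableSpace α] {ν : Measure α} [NormedAddCommGroup E]
    [NormedSpace ℝ E] {s : Finset ι}
    {u : ι → α → E} (hu : ∀ i, MemLp (u i) 2 ν) (w : ι → ℝ) :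
    MemLp (fun a => ∑ i ∈ s, w i • u i a) 2 ν :=
  memLp_finsetSum _ fun i _ => (hu i).const_smul (w i)

variable {M d m : ℕ} {Ξ : Type*} [MeasurableSpace Ξ] {α : Type*} [MeasurableSpace α]

theorem continuous_of_linear {E F : Type*} [NormedAddCommGroup E] [NormedSpace ℝ E]
    [FiniteDimensional ℝ E] [NormedAddCommGroup F] [NormedSpace ℝ F] (T : E →ₗ[ℝ] F) :
    Continuous T := T.continuous_of_finiteDimensional

theorem continuous_move (p : Params) : Continuous (move p : Pt d m → Pt d m) :=
  continuous_of_linear (moveLin p)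

theorem measurable_mix {u : α → Fin M → Pt d m} (hu : ∀ i, Measurable fun a => u a i)
    (W : Matrix (Fin M) (Fin M) ℝ) (i : Fin M) : Measurable fun a => mix W (u a) i :=
  measurable_sum_smul (u := fun j a => u a j) hu (W i)

theorem measurable_nextZ {st : α → State M d m} (hz : ∀ i, Measurable fun a => (st a).z i)
    (hdir : ∀ i, Measurable fun a => (st a).dir i) (p : Params) (W : Matrix (Fin M) (Fin M) ℝ)
    (i : Fin M) : Measurable fun a => nextZ p W (st a) i := by
  simp only [nextZ_eq]
  exact (measurable_mix hz W i).add ((continuous_move p).measurable.comp (hdir i))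

theorem measurable_batchGrad {g : Fin M → Pt d m → Ξ → Pt d m}
    (hg : ∀ i, Measurable (Function.uncurry (g i))) (S : ℕ) {u : α → Fin M → Pt d m}
    (hu : ∀ i, Measurable fun a => u a i) {c : α → Fin M → ℕ → Ξ} (hc : Measurable c) (i : Fin M) :
    Measurable fun a => batchGrad g S (u a) (c a) i := by
  refine measurable_smul_sum (u := fun s a => g i (u a i) (c a i s)) (fun s => ?_) _
  exact (hg i).comp ((hu i).prodMk ((measurable_pi_apply s).comp ((measurable_pi_apply i).comp hc)))

theorem measurable_nextV {g : Fin M → Pt d m → Ξ → Pt d m}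
    (hg : ∀ i, Measurable (Function.uncurry (g i))) {st : α → State M d m}
    (hz : ∀ i, Measurable fun a => (st a).z i) (hv : ∀ i, Measurable fun a => (st a).v i)
    (hdir : ∀ i, Measurable fun a => (st a).dir i) (p : Params) (W : Matrix (Fin M) (Fin M) ℝ)
    (t : ℕ) {c : α → Fin M → ℕ → Ξ} (hc : Measurable c) (i : Fin M) :
    Measurable fun a => nextV p W g t (c a) (st a) i := by
  unfold nextV
  split_ifs
  · exact measurable_batchGrad hg _ (measurable_nextZ hz hdir p W) hc i
  · exact ((measurable_batchGrad hg _ (measurable_nextZ hz hdir p W) hc i).sub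
      (measurable_batchGrad hg _ hz hc i)).add (hv i)

theorem measurable_run {g : Fin M → Pt d m → Ξ → Pt d m}
    (hg : ∀ i, Measurable (Function.uncurry (g i))) {D₀ : (Fin M → ℕ → Ξ) → Fin M → Pt d m}
    (hD₀ : Measurable D₀) (p : Params) (W : Matrix (Fin M) (Fin M) ℝ) (z₀ : Fin M → Pt d m)
    {c : α → ℕ → Fin M → ℕ → Ξ} (hc : ∀ k, Measurable fun a => c a k) (t : ℕ) :
    (∀ i, Measurable fun a => (run p W g z₀ D₀ (c a) t).z i) ∧
    (∀ i, Measurable fun a => (run p W g z₀ D₀ (c a) t).v i) ∧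
    (∀ i, Measurable fun a => (run p W g z₀ D₀ (c a) t).dir i) := by
  induction t with
  | zero =>
    refine ⟨fun i => measurable_const, ?_, ?_⟩
    · exact measurable_batchGrad hg p.S₁ (u := fun _ => z₀) (fun i => measurable_const) (hc 0)
    · exact fun i => (measurable_pi_apply i).comp (hD₀.comp (hc 0))
  | succ t ih =>
    obtain ⟨hz, hv, hdir⟩ := ih
    have hV := measurable_nextV hg hz hv hdir p W t (hc (t + 1))
    refine ⟨measurable_nextZ hz hdir p W, hV, ?_⟩
    exact measurable_mix (u := fun a i => (run p W g z₀ D₀ (c a) t).dir i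
      + nextV p W g t (c a (t + 1)) (run p W g z₀ D₀ (c a) t) i
      - (run p W g z₀ D₀ (c a) t).v i) (fun i => ((hdir i).add (hV i)).sub (hv i)) W

theorem run_congr {Ξ : Type*} (p : Params) (W : Matrix (Fin M) (Fin M) ℝ)
    (g : Fin M → Pt d m → Ξ → Pt d m) (z₀ : Fin M → Pt d m)
    (D₀ : (Fin M → ℕ → Ξ) → Fin M → Pt d m) {c c' : ℕ → Fin M → ℕ → Ξ} {t : ℕ}
    (h : ∀ k ≤ t, c k = c' k) : run p W g z₀ D₀ c t = run p W g z₀ D₀ c' t := by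
  induction t with
  | zero => simp only [run, h 0 le_rfl]
  | succ t ih =>
    simp only [run, h (t + 1) le_rfl, ih fun k hk => h k (hk.trans t.le_succ)]

/-- The state of time t is a function of the samples of times at most t. `State` carries no
σ-algebra, so independence is stated for a function `ψ` of the state. In the proof `ext` completes
the finitely many samples to a whole path, repeating the sample of time 0; by `run_congr` the
completion is irrelevant. -/
theorem indepFun_run {Ω γ : Type*} [MeasurableSpace Ω] {Pr : Measure Ω} [MeasurableSpace γ]
    {P : Fin M → Measure Ξ} {ξ : ℕ → Ω → Fin M → ℕ → Ξ} (hξ : IsSampling P Pr ξ)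
    {g : Fin M → Pt d m → Ξ → Pt d m}
    (p : Params) (W : Matrix (Fin M) (Fin M) ℝ) (z₀ : Fin M → Pt d m)
    (D₀ : (Fin M → ℕ → Ξ) → Fin M → Pt d m) (t : ℕ) {ψ : State M d m → γ}
    (hψ : ∀ c : (Finset.range (t + 1) → Fin M → ℕ → Ξ) → ℕ → Fin M → ℕ → Ξ,
      (∀ k, Measurable fun a => c a k) → Measurable fun a => ψ (run p W g z₀ D₀ (c a) t)) :
    IndepFun (fun ω => ψ (run p W g z₀ D₀ (fun k => ξ k ω) t)) (ξ (t + 1)) Pr := by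
  have h1 := hξ.indep_time.indepFun_finset (Finset.range (t + 1)) {t + 1}
    (by simp) hξ.measurable
  let ext : (Finset.range (t + 1) → Fin M → ℕ → Ξ) → ℕ → Fin M → ℕ → Ξ := fun a k =>
    if h : k ∈ Finset.range (t + 1) then a ⟨k, h⟩ else a ⟨0, by simp⟩
  have hext : ∀ k, Measurable fun a => ext a k := by
    intro k
    by_cases h : k ∈ Finset.range (t + 1)
    · simp only [ext, h, dite_true]; exact measurable_pi_apply _
    · simp only [ext, h, dite_false]; exact measurable_pi_apply _
  have h2 := h1.comp (hψ ext hext)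
    (measurable_pi_apply (⟨t + 1, by simp⟩ : ({t + 1} : Finset ℕ)))
  refine IndepFun.congr h2 (Filter.Eventually.of_forall fun ω => ?_) Filter.EventuallyEq.rfl
  simp only [Function.comp]
  congr 1
  refine run_congr p W g z₀ D₀ fun k hk => ?_
  have : k ∈ Finset.range (t + 1) := Finset.mem_range.2 (Nat.lt_succ_of_le hk)
  simp only [ext, this, dite_true]

end Measurability

section Lipschitz

variable {E E' : Type*} [NormedAddCommGroup E] [NormedAddCommGroup E'] {G : E → E'} {L : ℝ}

theorem continuous_of_norm_sub_le (hG : ∀ z z', ‖G z - G z'‖ ≤ L * ‖z - z'‖) : Continuous G :=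
  (LipschitzWith.of_dist_le_mul (K := L.toNNReal) fun z z' => by
    rw [dist_eq_norm, dist_eq_norm]
    exact (hG z z').trans (mul_le_mul_of_nonneg_right (Real.le_coe_toNNReal L)
      (norm_nonneg _))).continuous

variable {Ω : Type*} [MeasurableSpace Ω] {Pr : Measure Ω} [IsFiniteMeasure Pr]

theorem memLp_comp_of_norm_sub_le (hG : ∀ z z', ‖G z - G z'‖ ≤ L * ‖z - z'‖) {X : Ω → E}
    (hX : MemLp X 2 Pr) : MemLp (fun ω => G (X ω)) 2 Pr := by
  have h1 : MemLp (fun ω => ‖G 0‖ + L * ‖X ω‖) 2 Pr :=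
    (memLp_const ‖G 0‖).add (hX.norm.const_mul L)
  refine h1.mono' ((continuous_of_norm_sub_le hG).comp_aestronglyMeasurable hX.1)
    (Filter.Eventually.of_forall fun ω => ?_)
  have h2 := norm_add_le (G (X ω) - G 0) (G 0)
  have h3 := hG (X ω) 0
  rw [sub_add_cancel] at h2
  rw [sub_zero] at h3
  linarith

end Lipschitz

section SquareIntegrable

variable {Ω : Type*} [MeasurableSpace Ω] {Pr : Measure Ω} {E : Type*} [NormedAddCommGroup E]

theorem integrable_norm_sq {X : Ω → E} (hX : MemLp X 2 Pr) :
    Integrable (fun ω => ‖X ω‖ ^ 2) Pr :=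
  (memLp_two_iff_integrable_sq_norm hX.1).1 hX

theorem memLp_two_of_integrable [MeasurableSpace E] [BorelSpace E] [SecondCountableTopology E]
    {X : Ω → E} (hX : Measurable X) (h : Integrable (fun ω => ‖X ω‖ ^ 2) Pr) : MemLp X 2 Pr :=
  (memLp_two_iff_integrable_sq_norm hX.aestronglyMeasurable).2 h

theorem smul_sum_sub [NormedSpace ℝ E] {ι : Type*} {S : ℕ} (hS : 1 ≤ S) (u : ι → E) (n : ℕ → ι)
    (b : E) : (1 / (S : ℝ)) • ∑ s ∈ Finset.range S, (u (n s) - b)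
      = (1 / (S : ℝ)) • ∑ s ∈ Finset.range S, u (n s) - b := by
  have hS' : (S : ℝ) ≠ 0 := by positivity
  rw [Finset.sum_sub_distrib, smul_sub, Finset.sum_const, Finset.card_range,
    ← Nat.cast_smul_eq_nsmul ℝ, smul_smul, one_div_mul_cancel hS', one_smul]

end SquareIntegrable

/-! ### Conditioning on the past by freezing it -/

section Freeze

variable {Ω : Type*} [MeasurableSpace Ω] {Pr : Measure Ω}
  {E : Type*} [NormedAddCommGroup E] [InnerProductSpace ℝ E] [CompleteSpace E] [MeasurableSpace E]
  [BorelSpace E] [SecondCountableTopology E]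

/-- For a frozen value of the past `X` this is the batch estimate with deterministic centre;
independence allows integrating over `X` afterwards. -/
theorem integral_norm_add_batch_sq_le_of_indepFun [IsProbabilityMeasure Pr] {α Ξ ι : Type*}
    [MeasurableSpace α] [MeasurableSpace Ξ] {X : Ω → α} (hX : Measurable X)
    {Y : Ω → ι → ℕ → Ξ} (hY : Measurable Y) (hXY : IndepFun X Y Pr) {i : ι} {Q : Measure Ξ}
    (hU : iIndepFun (fun s ω => Y ω i s) Pr) (hQ : ∀ s, Pr.map (fun ω => Y ω i s) = Q)
    {a : α → E} (ha : Measurable a) {φ : α → Ξ → E} (hφ : Measurable (Function.uncurry φ))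
    (hφL : ∀ x, MemLp (φ x) 2 Q) (hφ0 : ∀ x, ∫ s, φ x s ∂Q = 0) {V : α → ℝ}
    (hV : ∀ x, ∫ s, ‖φ x s‖ ^ 2 ∂Q ≤ V x) {S : ℕ} (hS : 1 ≤ S)
    (hB : Integrable (fun ω => ‖a (X ω)‖ ^ 2 + V (X ω) / S) Pr) :
    Integrable (fun ω => ‖a (X ω) + (1 / (S : ℝ)) • ∑ s ∈ Finset.range S, φ (X ω) (Y ω i s)‖ ^ 2)
        Pr ∧
      ∫ ω, ‖a (X ω) + (1 / (S : ℝ)) • ∑ s ∈ Finset.range S, φ (X ω) (Y ω i s)‖ ^ 2 ∂Pr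
        ≤ ∫ ω, (‖a (X ω)‖ ^ 2 + V (X ω) / S) ∂Pr := by
  refine integrable_and_integral_le_of_indepFun hX hY hXY
    (F := fun x c => ‖a x + (1 / (S : ℝ)) • ∑ s ∈ Finset.range S, φ x (c i s)‖ ^ 2)
    (B := fun x => ‖a x‖ ^ 2 + V x / S) ?_ (fun _ _ => sq_nonneg _) (fun x => ?_) hB
  · have h1 : ∀ s, Measurable fun z : α × (ι → ℕ → Ξ) => φ z.1 (z.2 i s) := fun s =>
      hφ.comp (measurable_fst.prodMk
        ((measurable_pi_apply s).comp ((measurable_pi_apply i).comp measurable_snd)))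
    have h2 : Measurable fun z : α × (ι → ℕ → Ξ) => a z.1 := ha.comp measurable_fst
    have h3 := measurable_smul_sum (s := Finset.range S) h1 (1 / (S : ℝ))
    exact (h2.add h3).norm.pow_const 2
  · exact integral_norm_add_batch_sq_le hU
      (fun s => (measurable_pi_apply s).comp ((measurable_pi_apply i).comp hY)) hQ
      (hφ.comp measurable_prodMk_left) (hφL x) (hφ0 x) (hV x) hS (a x)

end Freeze

/-- The assumptions on the oracles, the samples, the network, the parameters and the
initialisation. -/
structure Setting {M d m : ℕ} {Ξ Ω : Type*} [MeasurableSpace Ξ] [MeasurableSpace Ω]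
    (Pr : Measure Ω) (P : Fin M → Measure Ξ) (f : Fin M → Pt d m → ℝ) (L σ : ℝ)
    (g : Fin M → Pt d m → Ξ → Pt d m) (ξ : ℕ → Ω → Fin M → ℕ → Ξ)
    (W : Matrix (Fin M) (Fin M) ℝ) (p : Params) (z₀ : Fin M → Pt d m)
    (D₀ : (Fin M → ℕ → Ξ) → Fin M → Pt d m) : Prop where
  M_pos : 0 < M
  L_pos : 0 < L
  oracle : IsOracle f g P σ L
  sampling : IsSampling P Pr ξ
  row_sum : ∀ i, ∑ j, W i j = 1
  col_sum : ∀ j, ∑ i, W i j = 1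
  rate_lt_one : mixingRate W < 1
  ηx_nonneg : 0 ≤ p.ηx
  ηx_le : p.ηx ≤ p.ηy
  S₁_pos : 1 ≤ p.S₁
  q_pos : 1 ≤ p.q
  q_le_S₂ : p.q ≤ p.S₂
  measurable_D₀ : Measurable D₀
  memLp_D₀ : ∀ i, MemLp (fun ω => D₀ (ξ 0 ω) i) 2 Pr
  avg_D₀ : ∀ c, avg (D₀ c) = avg (batchGrad g p.S₁ z₀ c)

/-! ### The random trajectory: conditional second moments of one step -/

namespace Setting

variable {M d m : ℕ} {Ξ Ω : Type*} [MeasurableSpace Ξ] [MeasurableSpace Ω]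
  {Pr : Measure Ω} {P : Fin M → Measure Ξ} {f : Fin M → Pt d m → ℝ} {L σ : ℝ}
  {g : Fin M → Pt d m → Ξ → Pt d m} {ξ : ℕ → Ω → Fin M → ℕ → Ξ}
  {W : Matrix (Fin M) (Fin M) ℝ} {p : Params} {z₀ : Fin M → Pt d m}
  {D₀ : (Fin M → ℕ → Ξ) → Fin M → Pt d m}

/-- The random state at time `t`. -/
def path (_ : Setting Pr P f L σ g ξ W p z₀ D₀) (t : ℕ) (ω : Ω) : State M d m :=
  run p W g z₀ D₀ (fun k => ξ k ω) t

variable (h : Setting Pr P f L σ g ξ W p z₀ D₀)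

/-- The error of the gradient estimator of agent `i`. -/
def err (t : ℕ) (i : Fin M) (ω : Ω) : Pt d m :=
  (h.path t ω).v i - gradient (f i) ((h.path t ω).z i)

/-- The displacement of agent `i` between times `t` and `t + 1`. -/
def disp (t : ℕ) (i : Fin M) (ω : Ω) : Pt d m :=
  (h.path (t + 1) ω).z i - (h.path t ω).z i

/-- The increment of the gradient estimator of agent `i` between times `t` and `t + 1`. -/
def incr (t : ℕ) (i : Fin M) (ω : Ω) : Pt d m :=
  (h.path (t + 1) ω).v i - (h.path t ω).v i

include h

theorem measurable_path (t : ℕ) :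
    (∀ i, Measurable fun ω => (h.path t ω).z i) ∧ (∀ i, Measurable fun ω => (h.path t ω).v i) ∧
      (∀ i, Measurable fun ω => (h.path t ω).dir i) :=
  measurable_run h.oracle.measurable h.measurable_D₀ p W z₀ h.sampling.measurable t

/-- The iterate of time t + 1 is computed from the state of time t alone, before the samples of time
t + 1 enter; so it may be frozen together with the past. -/
theorem indepFun_step (t : ℕ) (i : Fin M) :
    IndepFun (fun ω => ((h.path t ω).z i, (h.path (t + 1) ω).z i, (h.path t ω).v i))
      (ξ (t + 1)) Pr :=
  indepFun_run h.sampling p W z₀ D₀ t (ψ := fun st => (st.z i, nextZ p W st i, st.v i))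
    fun c hc => by
    obtain ⟨h1, h2, h3⟩ := measurable_run h.oracle.measurable h.measurable_D₀ p W z₀ hc t
    exact (h1 i).prodMk ((measurable_nextZ h1 h3 p W i).prodMk (h2 i))

theorem measurable_step (t : ℕ) (i : Fin M) :
    Measurable (fun ω => ((h.path t ω).z i, (h.path (t + 1) ω).z i, (h.path t ω).v i)) :=
  ((h.measurable_path t).1 i).prodMk
    (((h.measurable_path (t + 1)).1 i).prodMk ((h.measurable_path t).2.1 i))

theorem S₂_pos : 1 ≤ p.S₂ := h.q_pos.trans h.q_le_S₂

variable [∀ i, IsProbabilityMeasure (P i)]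

theorem gradient_lipschitz (i : Fin M) (z z' : Pt d m) :
    ‖gradient (f i) z - gradient (f i) z'‖ ≤ L * ‖z - z'‖ :=
  h.oracle.gradient_lipschitz h.L_pos.le i z z'

theorem measurable_gradient (i : Fin M) : Measurable (gradient (f i)) :=
  (continuous_of_norm_sub_le (h.gradient_lipschitz i)).measurable

theorem norm_gradient_sub_sq_le (i : Fin M) (z z' : Pt d m) :
    ‖gradient (f i) z - gradient (f i) z'‖ ^ 2 ≤ L ^ 2 * ‖z - z'‖ ^ 2 := by
  rw [← mul_pow]
  exact pow_le_pow_left₀ (norm_nonneg _) (h.gradient_lipschitz i z z') 2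

theorem measurable_err (t : ℕ) (i : Fin M) : Measurable (h.err t i) :=
  ((h.measurable_path t).2.1 i).sub ((h.measurable_gradient i).comp ((h.measurable_path t).1 i))

variable [IsProbabilityMeasure Pr]

theorem err_zero (i : Fin M) : Integrable (fun ω => ‖h.err 0 i ω‖ ^ 2) Pr ∧
    ∫ ω, ‖h.err 0 i ω‖ ^ 2 ∂Pr ≤ σ ^ 2 / p.S₁ := by
  have hn := integral_norm_add_batch_sq_le (h.sampling.indep_batch 0 i)
    (fun s => (measurable_pi_apply s).comp ((measurable_pi_apply i).comp (h.sampling.measurable 0)))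
    (h.sampling.law 0 i) (φ := fun s => g i (z₀ i) s - gradient (f i) (z₀ i))
    ((h.oracle.measurable_right i _).sub_const _) (h.oracle.memLp_noise i (z₀ i))
    (by rw [integral_sub (h.oracle.integrable i _) (integrable_const _), h.oracle.unbiased]; simp)
    (h.oracle.variance_le i (z₀ i)) h.S₁_pos 0
  have e : ∀ ω, (0 : Pt d m) + (1 / (p.S₁ : ℝ)) • ∑ s ∈ Finset.range p.S₁,
      (g i (z₀ i) (ξ 0 ω i s) - gradient (f i) (z₀ i)) = h.err 0 i ω := fun ω => by
    rw [smul_sum_sub h.S₁_pos (g i (z₀ i)), zero_add]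
    rfl
  simp only [e, norm_zero] at hn
  exact ⟨hn.1, hn.2.trans (by simp)⟩

/-- A large-batch step. -/
theorem large_step (t : ℕ) (i : Fin M) (ht : (t + p.r) % p.q = 0)
    {a : Pt d m × Pt d m × Pt d m → Pt d m}
    (ha : Measurable a)
    (hai : Integrable (fun ω => ‖a ((h.path t ω).z i, (h.path (t + 1) ω).z i,
      (h.path t ω).v i)‖ ^ 2) Pr) :
    Integrable (fun ω => ‖a ((h.path t ω).z i, (h.path (t + 1) ω).z i, (h.path t ω).v i)
      + h.err (t + 1) i ω‖ ^ 2) Pr ∧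
    ∫ ω, ‖a ((h.path t ω).z i, (h.path (t + 1) ω).z i, (h.path t ω).v i)
      + h.err (t + 1) i ω‖ ^ 2 ∂Pr
      ≤ ∫ ω, ‖a ((h.path t ω).z i, (h.path (t + 1) ω).z i, (h.path t ω).v i)‖ ^ 2 ∂Pr
        + σ ^ 2 / p.S₁ := by
  -- Given the past, the new error is a centred batch average of variance at most σ² / S₁. The past
  -- term `a` is left free: zero gives the error bound, and the new gradient minus the old estimator
  -- gives the increment bound.
  have hn := integral_norm_add_batch_sq_le_of_indepFun (h.measurable_step t i)
    (h.sampling.measurable (t + 1)) (h.indepFun_step t i) (h.sampling.indep_batch (t + 1) i)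
    (h.sampling.law (t + 1) i) ha
    (φ := fun x s => g i x.2.1 s - gradient (f i) x.2.1) (V := fun _ => σ ^ 2)
    (((h.oracle.measurable i).comp ((measurable_fst.comp (measurable_snd.comp
      measurable_fst)).prodMk measurable_snd)).sub ((h.measurable_gradient i).comp
      (measurable_fst.comp (measurable_snd.comp measurable_fst))))
    (fun x => h.oracle.memLp_noise i _)
    (fun x => by
      rw [integral_sub (h.oracle.integrable i _) (integrable_const _), h.oracle.unbiased]; simp)
    (fun x => h.oracle.variance_le i _) h.S₁_pos (hai.add (integrable_const _))
  have e : ∀ ω, (1 / (p.S₁ : ℝ)) • ∑ s ∈ Finset.range p.S₁,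
      (g i ((h.path (t + 1) ω).z i) (ξ (t + 1) ω i s) - gradient (f i) ((h.path (t + 1) ω).z i))
        = h.err (t + 1) i ω := fun ω => by
    rw [smul_sum_sub h.S₁_pos (g i ((h.path (t + 1) ω).z i)), err]
    congr 1
    have : (h.path (t + 1) ω).v i = nextV p W g t (ξ (t + 1) ω) (h.path t ω) i := rfl
    rw [this, nextV, if_pos ht]
    rfl
  simp only [e] at hn
  refine ⟨hn.1, hn.2.trans (le_of_eq ?_)⟩
  rw [integral_add hai (integrable_const _)]
  simp

/-- A small-batch step. -/
theorem small_step (t : ℕ) (i : Fin M) (ht : (t + p.r) % p.q ≠ 0)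
    (hd : Integrable (fun ω => ‖h.disp t i ω‖ ^ 2) Pr)
    {a : Pt d m × Pt d m × Pt d m → Pt d m} (ha : Measurable a)
    (hai : Integrable (fun ω => ‖a ((h.path t ω).z i, (h.path (t + 1) ω).z i,
      (h.path t ω).v i)‖ ^ 2) Pr) :
    Integrable (fun ω => ‖a ((h.path t ω).z i, (h.path (t + 1) ω).z i, (h.path t ω).v i)
      + (h.err (t + 1) i ω - h.err t i ω)‖ ^ 2) Pr ∧
    ∫ ω, ‖a ((h.path t ω).z i, (h.path (t + 1) ω).z i, (h.path t ω).v i)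
      + (h.err (t + 1) i ω - h.err t i ω)‖ ^ 2 ∂Pr
      ≤ ∫ ω, ‖a ((h.path t ω).z i, (h.path (t + 1) ω).z i, (h.path t ω).v i)‖ ^ 2 ∂Pr
        + L ^ 2 / p.S₂ * ∫ ω, ‖h.disp t i ω‖ ^ 2 ∂Pr := by
  have hdi : Integrable (fun ω => L ^ 2 * ‖h.disp t i ω‖ ^ 2 / p.S₂) Pr :=
    (hd.const_mul (L ^ 2)).div_const _
  have mz : Measurable fun x : (Pt d m × Pt d m × Pt d m) × Ξ => x.1.1 :=
    measurable_fst.comp measurable_fst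
  have mz' : Measurable fun x : (Pt d m × Pt d m × Pt d m) × Ξ => x.1.2.1 :=
    measurable_fst.comp (measurable_snd.comp measurable_fst)
  -- Both gradients use the same sample, so the change of the error is a centred batch average whose
  -- terms have second moment at most L² times the squared displacement. Taking `a` to be the old
  -- error gives the error recursion; taking it to be the gradient difference gives the increment
  -- bound.
  have hn := integral_norm_add_batch_sq_le_of_indepFun (h.measurable_step t i)
    (h.sampling.measurable (t + 1)) (h.indepFun_step t i) (h.sampling.indep_batch (t + 1) i)
    (h.sampling.law (t + 1) i) ha
    (φ := fun x s => (g i x.2.1 s - g i x.1 s)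
      - (gradient (f i) x.2.1 - gradient (f i) x.1))
    (V := fun x => L ^ 2 * ‖x.2.1 - x.1‖ ^ 2)
    ((((h.oracle.measurable i).comp (mz'.prodMk measurable_snd)).sub
      ((h.oracle.measurable i).comp (mz.prodMk measurable_snd))).sub
      (((h.measurable_gradient i).comp mz').sub ((h.measurable_gradient i).comp mz)))
    (fun x => (h.oracle.memLp_sub i _ _).sub (memLp_const _))
    (fun x => by
      rw [integral_sub (f := fun s => g i x.2.1 s - g i x.1 s)
        ((h.oracle.integrable i _).sub (h.oracle.integrable i _)) (integrable_const _), h.oracle.integral_sub]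
      simp)
    (fun x => h.oracle.integral_noise_sub_le i _ _) h.S₂_pos (hai.add hdi)
  have e : ∀ ω, (1 / (p.S₂ : ℝ)) • ∑ s ∈ Finset.range p.S₂,
      ((g i ((h.path (t + 1) ω).z i) (ξ (t + 1) ω i s) - g i ((h.path t ω).z i) (ξ (t + 1) ω i s))
        - (gradient (f i) ((h.path (t + 1) ω).z i) - gradient (f i) ((h.path t ω).z i)))
        = h.err (t + 1) i ω - h.err t i ω := fun ω => by
    rw [smul_sum_sub h.S₂_pos
      (fun s => g i ((h.path (t + 1) ω).z i) s - g i ((h.path t ω).z i) s), err, err]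
    have : (h.path (t + 1) ω).v i = nextV p W g t (ξ (t + 1) ω) (h.path t ω) i := rfl
    rw [this, nextV, if_neg ht, Finset.sum_sub_distrib, smul_sub]
    have e1 : batchGrad g p.S₂ (nextZ p W (h.path t ω)) (ξ (t + 1) ω) i
      = (1 / (p.S₂ : ℝ)) • ∑ s ∈ Finset.range p.S₂,
        g i ((h.path (t + 1) ω).z i) (ξ (t + 1) ω i s) := rfl
    have e2 : batchGrad g p.S₂ (h.path t ω).z (ξ (t + 1) ω) i
      = (1 / (p.S₂ : ℝ)) • ∑ s ∈ Finset.range p.S₂,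
        g i ((h.path t ω).z i) (ξ (t + 1) ω i s) := rfl
    rw [e1, e2]
    abel
  simp only [e] at hn
  refine ⟨hn.1, hn.2.trans (le_of_eq ?_)⟩
  refine (integral_add hai hdi).trans ?_
  rw [integral_div, integral_const_mul]
  ring

end Setting

/-! ### Summing geometric and periodically reset recursions -/

section Sequences

/-- Telescoping; the induction keeps the last term `a T` on the left and drops it at the end. -/
theorem sum_le_of_geometric {a b : ℕ → ℝ} {ρ : ℝ} (ha : ∀ t, 0 ≤ a t)
    (h : ∀ t, a (t + 1) ≤ ρ * a t + b t) (T : ℕ) :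
    (1 - ρ) * ∑ t ∈ Finset.range T, a t ≤ a 0 + ∑ t ∈ Finset.range T, b t := by
  have key : (1 - ρ) * ∑ t ∈ Finset.range T, a t + a T ≤ a 0 + ∑ t ∈ Finset.range T, b t := by
    induction T with
    | zero => simp
    | succ T ih =>
      rw [Finset.sum_range_succ, Finset.sum_range_succ]
      have := h T
      linarith
  have := ha T
  linarith

theorem add_one_mod_of_ne_zero {n q : ℕ} (h : (n + 1) % q ≠ 0) : (n + 1) % q = n % q + 1 := by
  rcases Nat.eq_zero_or_pos q with rfl | hq
  · simp
  have hd := Nat.div_add_mod n q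
  have hlt := Nat.mod_lt n hq
  have e : n + 1 = q * (n / q) + (n % q + 1) := by omega
  rcases Nat.lt_or_ge (n % q + 1) q with h1 | h1
  · calc (n + 1) % q = (q * (n / q) + (n % q + 1)) % q := by rw [← e]
      _ = n % q + 1 := by rw [Nat.mul_add_mod, Nat.mod_eq_of_lt h1]
  · refine absurd ?_ h
    calc (n + 1) % q = (q * (n / q) + (n % q + 1)) % q := by rw [← e]
      _ = 0 := by rw [Nat.mul_add_mod, show n % q + 1 = q by omega, Nat.mod_self]

/-- The window length `w` counts the small-batch steps since the last reset. The estimator of time t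
is a reset when q divides t - 1 + r, hence the bound by (t + r - 1) mod q; time 0 is also a reset,
hence `w ≤ t`. The truncated subtraction matters only at t = r = 0, where the window is empty. -/
theorem exists_window_le {e D : ℕ → ℝ} {c K : ℝ} {q r : ℕ} (h0 : e 0 ≤ c)
    (hlarge : ∀ t, (t + r) % q = 0 → e (t + 1) ≤ c)
    (hsmall : ∀ t, (t + r) % q ≠ 0 → e (t + 1) ≤ e t + K * D t) (t : ℕ) :
    ∃ w ≤ (t + r - 1) % q, w ≤ t ∧ e t ≤ c + K * ∑ k ∈ Finset.Ico (t - w) t, D k := by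
  induction t with
  | zero => exact ⟨0, Nat.zero_le _, le_rfl, by simpa using h0⟩
  | succ t ih =>
    by_cases ht : (t + r) % q = 0
    · exact ⟨0, Nat.zero_le _, Nat.zero_le _, by simpa using hlarge t ht⟩
    · obtain ⟨w, hw, hwt, he⟩ := ih
      have hpos : t + r ≠ 0 := fun h => ht (by rw [h, Nat.zero_mod])
      obtain ⟨n, hn⟩ : ∃ n, t + r = n + 1 := ⟨t + r - 1, by omega⟩
      have e3 : (n + 1) % q = n % q + 1 := add_one_mod_of_ne_zero (hn ▸ ht)
      rw [hn, Nat.add_sub_cancel] at hw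
      refine ⟨w + 1, ?_, by omega, ?_⟩
      · rw [show t + 1 + r - 1 = n + 1 by omega, e3]
        omega
      rw [show t + 1 - (w + 1) = t - w by omega, Finset.sum_Ico_succ_top (by omega)]
      have := hsmall t ht
      linarith

/-- Exchange of summation: `D k` enters the windows of at most q later times t, those with k < t ≤ k
+ q. -/
theorem sum_window_le {e D : ℕ → ℝ} {c K : ℝ} {q r : ℕ} (hq : 1 ≤ q) (hK : 0 ≤ K)
    (hD : ∀ t, 0 ≤ D t) (h0 : e 0 ≤ c) (hlarge : ∀ t, (t + r) % q = 0 → e (t + 1) ≤ c)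
    (hsmall : ∀ t, (t + r) % q ≠ 0 → e (t + 1) ≤ e t + K * D t) (T : ℕ) :
    ∑ t ∈ Finset.range T, e t ≤ T * c + K * q * ∑ t ∈ Finset.range T, D t := by
  have h1 : ∀ t ∈ Finset.range T, e t
      ≤ c + K * ∑ k ∈ Finset.range T, if k < t ∧ t ≤ k + q then D k else 0 := by
    intro t ht
    obtain ⟨w, hw, hwt, he⟩ := exists_window_le h0 hlarge hsmall t
    have hwq : w < q := hw.trans_lt (Nat.mod_lt _ hq)
    refine he.trans (add_le_add le_rfl (mul_le_mul_of_nonneg_left ?_ hK))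
    rw [← Finset.sum_filter]
    refine Finset.sum_le_sum_of_subset_of_nonneg (fun k hk => ?_) fun _ _ _ => hD _
    simp only [Finset.mem_Ico, Finset.mem_filter, Finset.mem_range] at hk ht ⊢
    omega
  have h2 : ∀ k ∈ Finset.range T, ∑ t ∈ Finset.range T, (if k < t ∧ t ≤ k + q then D k else 0)
      ≤ q * D k := by
    intro k _
    rw [← Finset.sum_filter, Finset.sum_const, nsmul_eq_mul]
    refine mul_le_mul_of_nonneg_right ?_ (hD k)
    have : ((Finset.range T).filter fun t => k < t ∧ t ≤ k + q) ⊆ Finset.Ioc k (k + q) :=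
      fun t ht => by
        simp only [Finset.mem_filter] at ht
        exact Finset.mem_Ioc.2 ht.2
    have := Finset.card_le_card this
    rw [Nat.card_Ioc] at this
    exact_mod_cast this.trans (by omega)
  calc ∑ t ∈ Finset.range T, e t
      ≤ ∑ t ∈ Finset.range T,
        (c + K * ∑ k ∈ Finset.range T, if k < t ∧ t ≤ k + q then D k else 0) :=
        Finset.sum_le_sum h1
    _ = T * c + K * ∑ k ∈ Finset.range T, ∑ t ∈ Finset.range T,
        (if k < t ∧ t ≤ k + q then D k else 0) := by
        rw [Finset.sum_add_distrib, Finset.sum_const, Finset.card_range, nsmul_eq_mul,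
          ← Finset.mul_sum, Finset.sum_comm]
    _ ≤ T * c + K * ∑ k ∈ Finset.range T, q * D k := by
        gcongr with k hk
        exact h2 k hk
    _ = _ := by rw [← Finset.mul_sum]; ring

end Sequences

theorem memLp_linear {Ω E F : Type*} [MeasurableSpace Ω] {Pr : Measure Ω} [NormedAddCommGroup E]
    [NormedSpace ℝ E] [FiniteDimensional ℝ E] [NormedAddCommGroup F] [NormedSpace ℝ F]
    (T : E →ₗ[ℝ] F) {X : Ω → E} (hX : MemLp X 2 Pr) : MemLp (fun ω => T (X ω)) 2 Pr :=
  (LinearMap.toContinuousLinearMap T).comp_memLp' hX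

/-! ### Square-integrability of the run, estimator errors and increments -/

namespace Setting

variable {M d m : ℕ} {Ξ Ω : Type*} [MeasurableSpace Ξ] [MeasurableSpace Ω]
  {Pr : Measure Ω} {P : Fin M → Measure Ξ} {f : Fin M → Pt d m → ℝ} {L σ : ℝ}
  {g : Fin M → Pt d m → Ξ → Pt d m} {ξ : ℕ → Ω → Fin M → ℕ → Ξ}
  {W : Matrix (Fin M) (Fin M) ℝ} {p : Params} {z₀ : Fin M → Pt d m}
  {D₀ : (Fin M → ℕ → Ξ) → Fin M → Pt d m}
  (h : Setting Pr P f L σ g ξ W p z₀ D₀)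
include h

theorem avg_dir (t : ℕ) (ω : Ω) : avg (h.path t ω).dir = avg (h.path t ω).v := by
  induction t with
  | zero => exact h.avg_D₀ _
  | succ t ih =>
    have e : (h.path (t + 1) ω).dir = mix W fun i => (h.path t ω).dir i
      + (h.path (t + 1) ω).v i - (h.path t ω).v i := rfl
    rw [e, avg_mix h.col_sum, avg_sub, avg_add, ih]
    abel

theorem avg_z_succ (t : ℕ) (ω : Ω) :
    avg (h.path (t + 1) ω).z = avg (h.path t ω).z + move p (avg (h.path t ω).v) := by
  rw [← h.avg_dir]
  exact avg_nextZ p h.col_sum _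

variable [∀ i, IsProbabilityMeasure (P i)] [IsProbabilityMeasure Pr]

/-- Joint induction: the old iterates and directions give the new iterate; the one-step bounds give
the new error, and adding the gradient at the new iterate gives the new estimator, hence the new
direction. -/
theorem memLp_path (t : ℕ) :
    (∀ i, MemLp (fun ω => (h.path t ω).z i) 2 Pr) ∧ (∀ i, MemLp (fun ω => (h.path t ω).v i) 2 Pr) ∧
      (∀ i, MemLp (fun ω => (h.path t ω).dir i) 2 Pr) := by
  have hv_of : ∀ t i, MemLp (fun ω => (h.path t ω).z i) 2 Pr →
      Integrable (fun ω => ‖h.err t i ω‖ ^ 2) Pr → MemLp (fun ω => (h.path t ω).v i) 2 Pr := by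
    intro t i hz he
    have h1 := (memLp_two_of_integrable (h.measurable_err t i) he).add
      (memLp_comp_of_norm_sub_le (h.gradient_lipschitz i) hz)
    refine h1.ae_eq (Filter.Eventually.of_forall fun ω => ?_)
    simp [err]
  induction t with
  | zero =>
    exact ⟨fun i => memLp_const (z₀ i),
      fun i => hv_of 0 i (memLp_const (z₀ i)) (h.err_zero i).1, h.memLp_D₀⟩
  | succ t ih =>
    obtain ⟨hz, hv, hdir⟩ := ih
    have hz' : ∀ i, MemLp (fun ω => (h.path (t + 1) ω).z i) 2 Pr := by
      intro i
      have h1 := (memLp_sum_smul (s := Finset.univ) hz (W i)).add (memLp_linear (moveLin p) (hdir i))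
      refine h1.ae_eq (Filter.Eventually.of_forall fun ω => ?_)
      exact (nextZ_eq p W (h.path t ω) i).symm
    have hv' : ∀ i, MemLp (fun ω => (h.path (t + 1) ω).v i) 2 Pr := by
      intro i
      refine hv_of (t + 1) i (hz' i) ?_
      by_cases ht : (t + p.r) % p.q = 0
      · have h1 := (h.large_step t i ht (a := fun _ => 0) measurable_const (by simp)).1
        simpa only [zero_add] using h1
      · have he : MemLp (h.err t i) 2 Pr :=
          (hv i).sub (memLp_comp_of_norm_sub_le (h.gradient_lipschitz i) (hz i))
        have h1 := (h.small_step t i ht (integrable_norm_sq ((hz' i).sub (hz i)))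
          (a := fun x => x.2.2 - gradient (f i) x.1)
          ((measurable_snd.comp measurable_snd).sub
            ((h.measurable_gradient i).comp measurable_fst)) (integrable_norm_sq he)).1
        refine h1.congr (Filter.Eventually.of_forall fun ω => ?_)
        simp only [err]
        congr 2
        abel
    refine ⟨hz', hv', fun i => ?_⟩
    have h1 : ∀ j, MemLp (fun ω => (h.path t ω).dir j + (h.path (t + 1) ω).v j
        - (h.path t ω).v j) 2 Pr := fun j => ((hdir j).add (hv' j)).sub (hv j)
    exact memLp_sum_smul (s := Finset.univ) h1 (W i)

theorem memLp_err (t : ℕ) (i : Fin M) : MemLp (h.err t i) 2 Pr :=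
  ((h.memLp_path t).2.1 i).sub
    (memLp_comp_of_norm_sub_le (h.gradient_lipschitz i) ((h.memLp_path t).1 i))

theorem memLp_disp (t : ℕ) (i : Fin M) : MemLp (h.disp t i) 2 Pr :=
  ((h.memLp_path (t + 1)).1 i).sub ((h.memLp_path t).1 i)

theorem memLp_incr (t : ℕ) (i : Fin M) : MemLp (h.incr t i) 2 Pr :=
  ((h.memLp_path (t + 1)).2.1 i).sub ((h.memLp_path t).2.1 i)

theorem integral_err_le_of_large (t : ℕ) (i : Fin M) (ht : (t + p.r) % p.q = 0) :
    ∫ ω, ‖h.err (t + 1) i ω‖ ^ 2 ∂Pr ≤ σ ^ 2 / p.S₁ := by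
  have h1 := (h.large_step t i ht (a := fun _ => 0) measurable_const (by simp)).2
  simpa only [zero_add, norm_zero, ne_eq, OfNat.ofNat_ne_zero, not_false_eq_true, zero_pow,
    integral_zero] using h1

theorem integral_err_le_of_small (t : ℕ) (i : Fin M) (ht : (t + p.r) % p.q ≠ 0) :
    ∫ ω, ‖h.err (t + 1) i ω‖ ^ 2 ∂Pr ≤ ∫ ω, ‖h.err t i ω‖ ^ 2 ∂Pr
      + L ^ 2 / p.S₂ * ∫ ω, ‖h.disp t i ω‖ ^ 2 ∂Pr := by
  have h1 := (h.small_step t i ht (integrable_norm_sq (h.memLp_disp t i))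
    (a := fun x => x.2.2 - gradient (f i) x.1)
    ((measurable_snd.comp measurable_snd).sub ((h.measurable_gradient i).comp measurable_fst))
    (integrable_norm_sq (h.memLp_err t i))).2
  refine le_trans (le_of_eq ?_) h1
  refine integral_congr_ae (Filter.Eventually.of_forall fun ω => ?_)
  simp only [err]
  congr 2
  abel

/-- A single bound for both kinds of step. After a large batch the increment is the gradient change
minus the old error, plus an independent fresh error; after a small batch it is the gradient change
plus centred noise, and L² + L² / S₂ ≤ 2L². -/
theorem integral_incr_le (t : ℕ) (i : Fin M) :
    ∫ ω, ‖h.incr t i ω‖ ^ 2 ∂Pr ≤ σ ^ 2 / p.S₁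
      + (2 * L ^ 2 * ∫ ω, ‖h.disp t i ω‖ ^ 2 ∂Pr + 2 * ∫ ω, ‖h.err t i ω‖ ^ 2 ∂Pr) := by
  have hz := (h.memLp_path t).1 i
  have hz' := (h.memLp_path (t + 1)).1 i
  have hG := memLp_comp_of_norm_sub_le (h.gradient_lipschitz i) hz
  have hG' := memLp_comp_of_norm_sub_le (h.gradient_lipschitz i) hz'
  have idisp := integrable_norm_sq (h.memLp_disp t i)
  have ierr := integrable_norm_sq (h.memLp_err t i)
  by_cases ht : (t + p.r) % p.q = 0
  · have ha : MemLp (fun ω => gradient (f i) ((h.path (t + 1) ω).z i) - (h.path t ω).v i) 2 Pr :=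
      hG'.sub ((h.memLp_path t).2.1 i)
    have h1 := (h.large_step t i ht (a := fun x => gradient (f i) x.2.1 - x.2.2)
      (((h.measurable_gradient i).comp (measurable_fst.comp measurable_snd)).sub
        (measurable_snd.comp measurable_snd)) (integrable_norm_sq ha)).2
    have h2 : ∫ ω, ‖gradient (f i) ((h.path (t + 1) ω).z i) - (h.path t ω).v i‖ ^ 2 ∂Pr
        ≤ ∫ ω, (2 * L ^ 2 * ‖h.disp t i ω‖ ^ 2 + 2 * ‖h.err t i ω‖ ^ 2) ∂Pr := by
      refine integral_mono (integrable_norm_sq ha)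
        ((idisp.const_mul _).add (ierr.const_mul _)) fun ω => ?_
      have e : gradient (f i) ((h.path (t + 1) ω).z i) - (h.path t ω).v i
        = (gradient (f i) ((h.path (t + 1) ω).z i) - gradient (f i) ((h.path t ω).z i))
          - h.err t i ω := by simp only [err]; abel
      have h3 := norm_sub_sq_le_two
        (gradient (f i) ((h.path (t + 1) ω).z i) - gradient (f i) ((h.path t ω).z i)) (h.err t i ω)
      have h4 := h.norm_gradient_sub_sq_le i ((h.path (t + 1) ω).z i) ((h.path t ω).z i)
      rw [← e] at h3
      change _ ≤ 2 * L ^ 2 * ‖(h.path (t + 1) ω).z i - (h.path t ω).z i‖ ^ 2 + _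
      linarith
    rw [integral_add (idisp.const_mul _) (ierr.const_mul _), integral_const_mul,
      integral_const_mul] at h2
    have h5 : ∫ ω, ‖h.incr t i ω‖ ^ 2 ∂Pr = ∫ ω, ‖gradient (f i) ((h.path (t + 1) ω).z i)
        - (h.path t ω).v i + h.err (t + 1) i ω‖ ^ 2 ∂Pr := by
      refine integral_congr_ae (Filter.Eventually.of_forall fun ω => ?_)
      simp only [err, incr]
      congr 2
      abel
    rw [h5]
    linarith
  · have ha : MemLp (fun ω => gradient (f i) ((h.path (t + 1) ω).z i)
        - gradient (f i) ((h.path t ω).z i)) 2 Pr := hG'.sub hG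
    have h1 := (h.small_step t i ht idisp
      (a := fun x => gradient (f i) x.2.1 - gradient (f i) x.1)
      (((h.measurable_gradient i).comp (measurable_fst.comp measurable_snd)).sub
        ((h.measurable_gradient i).comp measurable_fst)) (integrable_norm_sq ha)).2
    have h2 : ∫ ω, ‖gradient (f i) ((h.path (t + 1) ω).z i)
        - gradient (f i) ((h.path t ω).z i)‖ ^ 2 ∂Pr ≤ ∫ ω, L ^ 2 * ‖h.disp t i ω‖ ^ 2 ∂Pr :=
      integral_mono (integrable_norm_sq ha) (idisp.const_mul _) fun ω =>
        h.norm_gradient_sub_sq_le i _ _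
    rw [integral_const_mul] at h2
    have h5 : ∫ ω, ‖h.incr t i ω‖ ^ 2 ∂Pr = ∫ ω, ‖gradient (f i) ((h.path (t + 1) ω).z i)
        - gradient (f i) ((h.path t ω).z i) + (h.err (t + 1) i ω - h.err t i ω)‖ ^ 2 ∂Pr := by
      refine integral_congr_ae (Filter.Eventually.of_forall fun ω => ?_)
      simp only [err, incr]
      congr 2
      abel
    have hS : (1 : ℝ) ≤ p.S₂ := by exact_mod_cast h.S₂_pos
    have h6 : L ^ 2 / p.S₂ ≤ L ^ 2 := div_le_self (sq_nonneg L) hS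
    have h7 : 0 ≤ ∫ ω, ‖h.disp t i ω‖ ^ 2 ∂Pr := integral_nonneg fun _ => sq_nonneg _
    have h8 : 0 ≤ ∫ ω, ‖h.err t i ω‖ ^ 2 ∂Pr := integral_nonneg fun _ => sq_nonneg _
    have h9 := mul_le_mul_of_nonneg_right h6 h7
    have h10 : 0 ≤ σ ^ 2 / p.S₁ := by positivity
    rw [h5]
    linarith

end Setting

/-! ### Integrating pointwise inequalities; integrability of the primal quantities -/

section Integrals

variable {Ω : Type*} [MeasurableSpace Ω] {Pr : Measure Ω}

theorem integral_le_two {a b c : Ω → ℝ} {k l : ℝ} (ha : Integrable a Pr) (hb : Integrable b Pr)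
    (hc : Integrable c Pr) (h : ∀ ω, a ω ≤ k * b ω + l * c ω) :
    ∫ ω, a ω ∂Pr ≤ k * ∫ ω, b ω ∂Pr + l * ∫ ω, c ω ∂Pr := by
  refine (integral_mono ha ((hb.const_mul k).add (hc.const_mul l)) h).trans (le_of_eq ?_)
  rw [← integral_const_mul, ← integral_const_mul]
  exact integral_add (hb.const_mul k) (hc.const_mul l)

theorem integral_le_three {a b c e : Ω → ℝ} {k l n : ℝ} (ha : Integrable a Pr)
    (hb : Integrable b Pr) (hc : Integrable c Pr) (he : Integrable e Pr)
    (h : ∀ ω, a ω ≤ k * b ω + l * c ω + n * e ω) :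
    ∫ ω, a ω ∂Pr ≤ k * ∫ ω, b ω ∂Pr + l * ∫ ω, c ω ∂Pr + n * ∫ ω, e ω ∂Pr := by
  have h1 := integral_le_two (k := 1) (l := n) ha ((hb.const_mul k).add (hc.const_mul l)) he
    fun ω => by simpa using h ω
  have h2 := integral_le_two (k := k) (l := l) ((hb.const_mul k).add (hc.const_mul l)) hb hc
    fun ω => le_rfl
  linarith

theorem integral_le_five {a b c e b' c' : Ω → ℝ} {k l n k' l' : ℝ} (ha : Integrable a Pr)
    (hb : Integrable b Pr) (hc : Integrable c Pr) (he : Integrable e Pr)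
    (hb' : Integrable b' Pr) (hc' : Integrable c' Pr)
    (h : ∀ ω, a ω ≤ k * b ω + l * c ω + n * e ω + k' * b' ω + l' * c' ω) :
    ∫ ω, a ω ∂Pr ≤ k * ∫ ω, b ω ∂Pr + l * ∫ ω, c ω ∂Pr + n * ∫ ω, e ω ∂Pr
      + k' * ∫ ω, b' ω ∂Pr + l' * ∫ ω, c' ω ∂Pr := by
  have i3 := ((hb.const_mul k).add (hc.const_mul l)).add (he.const_mul n)
  have h1 := integral_le_three (k := 1) (l := k') (n := l') ha i3 hb' hc'
    fun ω => by simpa using h ω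
  have h2 := integral_le_three (k := k) (l := l) (n := n) i3 hb hc he fun ω => le_rfl
  linarith

variable {E : Type*} [NormedAddCommGroup E] [InnerProductSpace ℝ E] {M : ℕ}

theorem memLp_avg {u : Fin M → Ω → E} (hu : ∀ i, MemLp (u i) 2 Pr) :
    MemLp (fun ω => avg fun i => u i ω) 2 Pr :=
  (memLp_finsetSum Finset.univ fun i _ => hu i).const_smul (1 / (M : ℝ))

omit [InnerProductSpace ℝ E] in
theorem integrable_sum_norm_sq {u : Fin M → Ω → E} (hu : ∀ i, MemLp (u i) 2 Pr) :
    Integrable (fun ω => ∑ i, ‖u i ω‖ ^ 2) Pr :=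
  integrable_finsetSum _ fun i _ => integrable_norm_sq (hu i)

omit [InnerProductSpace ℝ E] in
theorem integral_sum_norm_sq {u : Fin M → Ω → E} (hu : ∀ i, MemLp (u i) 2 Pr) :
    ∫ ω, ∑ i, ‖u i ω‖ ^ 2 ∂Pr = ∑ i, ∫ ω, ‖u i ω‖ ^ 2 ∂Pr :=
  integral_finsetSum _ fun i _ => integrable_norm_sq (hu i)

theorem inv_natCast_nonneg (n : ℕ) : 0 ≤ 1 / (n : ℝ) := by positivity

end Integrals

section Pairs

variable {d m : ℕ} {Ω : Type*} [MeasurableSpace Ω] {Pr : Measure Ω}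

theorem memLp_fst {X : Ω → Pt d m} (hX : MemLp X 2 Pr) : MemLp (fun ω => (X ω).fst) 2 Pr := by
  have hc : Continuous fun z : Pt d m => z.fst := (WithLp.prod_continuous_ofLp 2 _ _).fst
  exact hX.mono (hc.comp_aestronglyMeasurable hX.1)
    (Filter.Eventually.of_forall fun ω => norm_fst_le _)

theorem memLp_snd {X : Ω → Pt d m} (hX : MemLp X 2 Pr) : MemLp (fun ω => (X ω).snd) 2 Pr := by
  have hc : Continuous fun z : Pt d m => z.snd := (WithLp.prod_continuous_ofLp 2 _ _).snd
  exact hX.mono (hc.comp_aestronglyMeasurable hX.1)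
    (Filter.Eventually.of_forall fun ω => norm_snd_le _)

theorem integrable_consensusErr {M : ℕ} {u : Ω → Fin M → Pt d m}
    (hu : ∀ i, MemLp (fun ω => u ω i) 2 Pr) : Integrable (fun ω => consensusErr (u ω)) Pr :=
  integrable_sum_norm_sq fun i => (hu i).sub (memLp_avg hu)

namespace IsSaddle

variable {F : Pt d m → ℝ} {L μ : ℝ} (hF : IsSaddle F L μ)
include hF

theorem norm_gradient_max_sub_le (x x' : EuclideanSpace ℝ (Fin d)) :
    ‖(gradient F (pt x (argmax F x))).fst - (gradient F (pt x' (argmax F x'))).fst‖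
      ≤ L * (1 + L / μ) * ‖x - x'‖ := by
  have h1 := (norm_fst_le _).trans (hF.lipschitz (pt x (argmax F x)) (pt x' (argmax F x')))
  have h2 := hF.norm_argmax_sub_le x x'
  have h3 : ‖pt x (argmax F x) - pt x' (argmax F x')‖ ≤ (1 + L / μ) * ‖x - x'‖ := by
    have hL := hF.L_pos
    have hμ := hF.μ_pos
    rw [← sq_le_sq₀ (norm_nonneg _) (by positivity), norm_sq_pt]
    simp only [WithLp.sub_fst, WithLp.sub_snd, pt_fst, pt_snd]
    have h4 := pow_le_pow_left₀ (norm_nonneg _) h2 2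
    have h5 : 0 ≤ L / μ * ‖x - x'‖ ^ 2 := by positivity
    linarith
  have := mul_le_mul_of_nonneg_left h3 hF.L_pos.le
  rw [WithLp.sub_fst] at h1
  linarith

variable [IsFiniteMeasure Pr] {X : Ω → EuclideanSpace ℝ (Fin d)} (hX : MemLp X 2 Pr)
include hX

theorem memLp_gradient_max :
    MemLp (fun ω => (gradient F (pt (X ω) (argmax F (X ω)))).fst) 2 Pr :=
  memLp_comp_of_norm_sub_le hF.norm_gradient_max_sub_le hX

theorem memLp_argmax : MemLp (fun ω => argmax F (X ω)) 2 Pr :=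
  memLp_comp_of_norm_sub_le hF.norm_argmax_sub_le hX

/-- The expansion at 0 shows that the primal function grows at most quadratically. -/
theorem integrable_max : Integrable (fun ω => F (pt (X ω) (argmax F (X ω)))) Pr := by
  set G := (gradient F (pt 0 (argmax F 0))).fst with hG
  set C := L * (1 + (L / μ) ^ 2) with hC
  have hc : Continuous fun x => F (pt x (argmax F x)) :=
    continuous_of_differentiable fun x => (hF.hasGradientAt_max x).differentiableAt
  have hi : Integrable (fun ω => |F (pt 0 (argmax F 0))| + ‖G‖ * ‖X ω‖ + C * ‖X ω‖ ^ 2) Pr :=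
    ((integrable_const _).add ((hX.integrable (by norm_num)).norm.const_mul _)).add
      ((integrable_norm_sq hX).const_mul _)
  refine hi.mono' (hc.comp_aestronglyMeasurable hX.1) (Filter.Eventually.of_forall fun ω => ?_)
  have h1 := hF.abs_max_sub_sub_inner_le 0 (X ω)
  rw [sub_zero, ← hG, ← hC] at h1
  have h2 := abs_real_inner_le_norm G (X ω)
  rw [Real.norm_eq_abs]
  rw [abs_le] at h1 h2 ⊢
  have h3 := neg_abs_le (F (pt 0 (argmax F 0)))
  have h4 := le_abs_self (F (pt 0 (argmax F 0)))
  constructor <;> linarith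

end IsSaddle

end Pairs

/-! ### Expected recursions for errors, displacements and consensus -/

namespace Setting

variable {M d m : ℕ} {Ξ Ω : Type*} [MeasurableSpace Ξ] [MeasurableSpace Ω]
  {Pr : Measure Ω} {P : Fin M → Measure Ξ} {f : Fin M → Pt d m → ℝ} {L σ : ℝ}
  {g : Fin M → Pt d m → Ξ → Pt d m} {ξ : ℕ → Ω → Fin M → ℕ → Ξ}
  {W : Matrix (Fin M) (Fin M) ℝ} {p : Params} {z₀ : Fin M → Pt d m}
  {D₀ : (Fin M → ℕ → Ξ) → Fin M → Pt d m}
  (h : Setting Pr P f L σ g ξ W p z₀ D₀)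

/-- The mean consensus error of the iterates. -/
def meanConsZ (t : ℕ) : ℝ := 1 / (M : ℝ) * ∫ ω, consensusErr (h.path t ω).z ∂Pr

/-- The mean consensus error of the tracking variables. -/
def meanConsDir (t : ℕ) : ℝ := 1 / (M : ℝ) * ∫ ω, consensusErr (h.path t ω).dir ∂Pr

/-- The mean squared error of the gradient estimators. -/
def meanErr (t : ℕ) : ℝ := 1 / (M : ℝ) * ∑ i, ∫ ω, ‖h.err t i ω‖ ^ 2 ∂Pr

/-- The mean squared displacement of the agents. -/
def meanDisp (t : ℕ) : ℝ := 1 / (M : ℝ) * ∑ i, ∫ ω, ‖h.disp t i ω‖ ^ 2 ∂Pr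

include h

theorem meanConsZ_nonneg (t : ℕ) : 0 ≤ h.meanConsZ t :=
  mul_nonneg (inv_natCast_nonneg M) (integral_nonneg fun _ => consensusErr_nonneg _)

theorem meanConsDir_nonneg (t : ℕ) : 0 ≤ h.meanConsDir t :=
  mul_nonneg (inv_natCast_nonneg M) (integral_nonneg fun _ => consensusErr_nonneg _)

theorem meanErr_nonneg (t : ℕ) : 0 ≤ h.meanErr t :=
  mul_nonneg (inv_natCast_nonneg M) (Finset.sum_nonneg fun _ _ => integral_nonneg fun _ => sq_nonneg _)

theorem meanDisp_nonneg (t : ℕ) : 0 ≤ h.meanDisp t :=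
  mul_nonneg (inv_natCast_nonneg M) (Finset.sum_nonneg fun _ _ => integral_nonneg fun _ => sq_nonneg _)

theorem mean_le_of_le {u : Fin M → ℝ} {c : ℝ} (hu : ∀ i, u i ≤ c) :
    1 / (M : ℝ) * ∑ i, u i ≤ c := by
  have hM : (0 : ℝ) < M := by exact_mod_cast h.M_pos
  rw [one_div_mul_eq_div, div_le_iff₀ hM]
  refine (Finset.sum_le_sum fun i _ => hu i).trans (le_of_eq ?_)
  simp [mul_comm]

variable [∀ i, IsProbabilityMeasure (P i)] [IsProbabilityMeasure Pr]

/-- Each displacement is charged at most q times at rate L² / S₂, and q ≤ S₂ leaves the factor L².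
-/
theorem sum_meanErr_le (T : ℕ) : ∑ t ∈ Finset.range T, h.meanErr t
    ≤ T * (σ ^ 2 / p.S₁) + L ^ 2 * ∑ t ∈ Finset.range T, h.meanDisp t := by
  have hS : (0 : ℝ) < p.S₂ := by exact_mod_cast h.S₂_pos
  refine (sum_window_le (K := L ^ 2 / p.S₂) (q := p.q) (r := p.r) (c := σ ^ 2 / p.S₁) h.q_pos
    (by positivity) h.meanDisp_nonneg
    (h.mean_le_of_le fun i => (h.err_zero i).2)
    (fun t ht => h.mean_le_of_le fun i => h.integral_err_le_of_large t i ht)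
    (fun t ht => ?_) T).trans ?_
  · have h1 := mul_le_mul_of_nonneg_left (Finset.sum_le_sum fun i (_ : i ∈ Finset.univ) =>
      h.integral_err_le_of_small t i ht) (inv_natCast_nonneg M)
    rw [Finset.sum_add_distrib, ← Finset.mul_sum] at h1
    refine h1.trans (le_of_eq ?_)
    simp only [meanErr, meanDisp]
    ring
  · refine add_le_add le_rfl (mul_le_mul_of_nonneg_right ?_
      (Finset.sum_nonneg fun t _ => h.meanDisp_nonneg t))
    rw [div_mul_eq_mul_div, div_le_iff₀ hS]
    exact mul_le_mul_of_nonneg_left (by exact_mod_cast h.q_le_S₂) (sq_nonneg L)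

theorem meanConsZ_succ_le (t : ℕ) : h.meanConsZ (t + 1) ≤ mixingRate W * h.meanConsZ t
    + 2 * p.ηy ^ 2 / (1 - mixingRate W) * h.meanConsDir t := by
  have h1 := mul_le_mul_of_nonneg_left (integral_le_two
    (integrable_consensusErr (h.memLp_path (t + 1)).1) (integrable_consensusErr (h.memLp_path t).1)
    (integrable_consensusErr (h.memLp_path t).2.2) (k := mixingRate W)
    (l := 2 * p.ηy ^ 2 / (1 - mixingRate W)) fun ω =>
      (consensusErr_nextZ_le h.M_pos h.row_sum h.col_sum h.rate_lt_one h.ηx_nonneg h.ηx_le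
        (h.path t ω)).trans (le_of_eq (by ring))) (inv_natCast_nonneg M)
  refine h1.trans (le_of_eq ?_)
  simp only [meanConsZ, meanConsDir]
  ring

theorem meanConsDir_succ_le (t : ℕ) : h.meanConsDir (t + 1) ≤ mixingRate W * h.meanConsDir t
    + 2 / (1 - mixingRate W) * (σ ^ 2 / p.S₁ + 2 * L ^ 2 * h.meanDisp t + 2 * h.meanErr t) := by
  have hg : 0 < 1 - mixingRate W := by linarith [h.rate_lt_one]
  have h1 := mul_le_mul_of_nonneg_left (integral_le_two
    (integrable_consensusErr (h.memLp_path (t + 1)).2.2)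
    (integrable_consensusErr (h.memLp_path t).2.2)
    (integrable_sum_norm_sq (h.memLp_incr t)) (k := mixingRate W)
    (l := 2 / (1 - mixingRate W)) fun ω => by
      have e : (h.path (t + 1) ω).dir = mix W fun i => (h.path t ω).dir i + h.incr t i ω := by
        have e1 : (h.path (t + 1) ω).dir = mix W fun i => (h.path t ω).dir i
          + (h.path (t + 1) ω).v i - (h.path t ω).v i := rfl
        rw [e1]
        congr 1
        funext i
        simp only [incr, add_sub_assoc]
      rw [e]
      exact consensusErr_mix_add_le h.M_pos h.row_sum h.col_sum h.rate_lt_one _ _) (inv_natCast_nonneg M)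
  rw [integral_sum_norm_sq (h.memLp_incr t)] at h1
  have h2 : 1 / (M : ℝ) * ∑ i, ∫ ω, ‖h.incr t i ω‖ ^ 2 ∂Pr
      ≤ σ ^ 2 / p.S₁ + 2 * L ^ 2 * h.meanDisp t + 2 * h.meanErr t := by
    have h3 := mul_le_mul_of_nonneg_left (Finset.sum_le_sum fun i (_ : i ∈ Finset.univ) =>
      h.integral_incr_le t i) (inv_natCast_nonneg M)
    refine h3.trans (le_of_eq ?_)
    have hM : (M : ℝ) ≠ 0 := by exact_mod_cast h.M_pos.ne'
    rw [Finset.sum_add_distrib, Finset.sum_add_distrib, ← Finset.mul_sum, ← Finset.mul_sum]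
    simp only [Finset.sum_const, Finset.card_univ, Fintype.card_fin, nsmul_eq_mul, meanDisp,
      meanErr]
    field_simp
    ring
  have h4 := mul_le_mul_of_nonneg_left h2 (by positivity : 0 ≤ 2 / (1 - mixingRate W))
  simp only [meanConsDir] at h1 ⊢
  linarith

theorem memLp_avg_z (t : ℕ) : MemLp (fun ω => avg (h.path t ω).z) 2 Pr :=
  memLp_avg (h.memLp_path t).1

theorem memLp_avg_v (t : ℕ) : MemLp (fun ω => avg (h.path t ω).v) 2 Pr :=
  memLp_avg (h.memLp_path t).2.1

theorem meanDisp_le (t : ℕ) : h.meanDisp t ≤ 3 * (4 * h.meanConsZ t + p.ηy ^ 2 * h.meanConsDir t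
    + p.ηx ^ 2 * ∫ ω, ‖(avg (h.path t ω).v).fst‖ ^ 2 ∂Pr
    + p.ηy ^ 2 * ∫ ω, ‖(avg (h.path t ω).v).snd‖ ^ 2 ∂Pr) := by
  have h1 := integral_le_five (k := 12 * (1 / (M : ℝ))) (l := 3 * p.ηy ^ 2 * (1 / (M : ℝ)))
    (n := 3 * p.ηx ^ 2) (k' := 3 * p.ηy ^ 2) (l' := 0)
    ((integrable_sum_norm_sq (h.memLp_disp t)).const_mul (1 / (M : ℝ)))
    (integrable_consensusErr (h.memLp_path t).1) (integrable_consensusErr (h.memLp_path t).2.2)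
    (integrable_norm_sq (memLp_fst (h.memLp_avg_v t)))
    (integrable_norm_sq (memLp_snd (h.memLp_avg_v t))) (integrable_const 0) fun ω => by
      have h2 := sum_norm_nextZ_sub_le h.M_pos h.row_sum h.rate_lt_one h.ηx_nonneg h.ηx_le
        (h.path t ω)
      rw [h.avg_dir] at h2
      refine h2.trans (le_of_eq ?_)
      ring
  rw [integral_const_mul, integral_sum_norm_sq (h.memLp_disp t)] at h1
  refine h1.trans (le_of_eq ?_)
  simp only [meanConsZ, meanConsDir]
  ring

end Setting

/-- The global objective as a function of the pair. -/
def mean {M d m : ℕ} (f : Fin M → Pt d m → ℝ) (z : Pt d m) : ℝ := (1 / (M : ℝ)) * ∑ i, f i z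

/-! ### Expected descent of the averaged iterate, and summation over time -/

namespace Setting

variable {M d m : ℕ} {Ξ Ω : Type*} [MeasurableSpace Ξ] [MeasurableSpace Ω]
  {Pr : Measure Ω} {P : Fin M → Measure Ξ} {f : Fin M → Pt d m → ℝ} {L σ : ℝ}
  {g : Fin M → Pt d m → Ξ → Pt d m} {ξ : ℕ → Ω → Fin M → ℕ → Ξ}
  {W : Matrix (Fin M) (Fin M) ℝ} {p : Params} {z₀ : Fin M → Pt d m}
  {D₀ : (Fin M → ℕ → Ξ) → Fin M → Pt d m}
  (h : Setting Pr P f L σ g ξ W p z₀ D₀)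

/-- The expected squared error of the averaged estimator at the averaged iterate. -/
def avgErr (t : ℕ) : ℝ :=
  ∫ ω, ‖avg (h.path t ω).v - gradient (mean f) (avg (h.path t ω).z)‖ ^ 2 ∂Pr

/-- The expected squared distance to the best response. -/
def gap (t : ℕ) : ℝ := ∫ ω, gapSq (mean f) (avg (h.path t ω).z) ∂Pr

/-- The expected squared norm of the gradient of the primal function. -/
def gradSq (t : ℕ) : ℝ := ∫ ω, ‖(gradient (mean f) (pt (avg (h.path t ω).z).fst
  (argmax (mean f) (avg (h.path t ω).z).fst))).fst‖ ^ 2 ∂Pr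

/-- The expected value of the primal function. -/
def value (t : ℕ) : ℝ := ∫ ω, mean f (pt (avg (h.path t ω).z).fst
  (argmax (mean f) (avg (h.path t ω).z).fst)) ∂Pr

/-- The expected squared norm of the averaged estimator of the `x`-gradient. -/
def dirX (t : ℕ) : ℝ := ∫ ω, ‖(avg (h.path t ω).v).fst‖ ^ 2 ∂Pr

/-- The expected squared norm of the averaged estimator of the `y`-gradient. -/
def dirY (t : ℕ) : ℝ := ∫ ω, ‖(avg (h.path t ω).v).snd‖ ^ 2 ∂Pr

variable {μ : ℝ} [∀ i, IsProbabilityMeasure (P i)] [IsProbabilityMeasure Pr]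
include h

omit [IsProbabilityMeasure Pr] in
-- The error splits into the average of the gradient changes from the local iterates to their mean,
-- controlled by consensus, and the average of the local estimator errors.
theorem norm_avg_sub_gradient_sq_le (hf : ∀ i, Differentiable ℝ (f i)) (t : ℕ) (ω : Ω) :
    ‖avg (h.path t ω).v - gradient (mean f) (avg (h.path t ω).z)‖ ^ 2
      ≤ 2 * L ^ 2 * (1 / (M : ℝ)) * consensusErr (h.path t ω).z
        + 2 * (1 / (M : ℝ)) * ∑ i, ‖h.err t i ω‖ ^ 2 := by
  have e : avg (h.path t ω).v - gradient (mean f) (avg (h.path t ω).z)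
      = avg (fun i => gradient (f i) ((h.path t ω).z i)
        - gradient (f i) (avg (h.path t ω).z)) + avg (fun i => h.err t i ω) := by
    have e1 : gradient (mean f) (avg (h.path t ω).z)
        = avg fun i => gradient (f i) (avg (h.path t ω).z) := gradient_mean hf _
    rw [e1, ← avg_sub, ← avg_add]
    congr 1
    funext i
    simp only [err]
    abel
  have h1 := norm_avg_sq_le h.M_pos fun i => gradient (f i) ((h.path t ω).z i)
        - gradient (f i) (avg (h.path t ω).z)
  have h2 := norm_avg_sq_le h.M_pos fun i => h.err t i ω
  have h3 := norm_add_sq_le_two (avg (fun i => gradient (f i) ((h.path t ω).z i)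
        - gradient (f i) (avg (h.path t ω).z))) (avg (fun i => h.err t i ω))
  have h4 : ∑ i, ‖gradient (f i) ((h.path t ω).z i) - gradient (f i) (avg (h.path t ω).z)‖ ^ 2
      ≤ L ^ 2 * consensusErr (h.path t ω).z := by
    rw [consensusErr, Finset.mul_sum]
    exact Finset.sum_le_sum fun i _ => h.norm_gradient_sub_sq_le i _ _
  have h5 := mul_le_mul_of_nonneg_left h4 (inv_natCast_nonneg M)
  rw [e]
  linarith

variable (hF : IsSaddle (mean f) L μ)
include hF

theorem memLp_avg_err (t : ℕ) : MemLp (fun ω => avg (h.path t ω).v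
    - gradient (mean f) (avg (h.path t ω).z)) 2 Pr :=
  (h.memLp_avg_v t).sub (memLp_comp_of_norm_sub_le hF.lipschitz (h.memLp_avg_z t))

theorem integrable_gapSq (t : ℕ) :
    Integrable (fun ω => gapSq (mean f) (avg (h.path t ω).z)) Pr :=
  integrable_norm_sq ((hF.memLp_argmax (memLp_fst (h.memLp_avg_z t))).sub
    (memLp_snd (h.memLp_avg_z t)))

theorem integrable_gradSq (t : ℕ) : Integrable (fun ω => ‖(gradient (mean f)
    (pt (avg (h.path t ω).z).fst (argmax (mean f) (avg (h.path t ω).z).fst))).fst‖ ^ 2) Pr :=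
  integrable_norm_sq (hF.memLp_gradient_max (memLp_fst (h.memLp_avg_z t)))

theorem integrable_value (t : ℕ) : Integrable (fun ω => mean f
    (pt (avg (h.path t ω).z).fst (argmax (mean f) (avg (h.path t ω).z).fst))) Pr :=
  hF.integrable_max (memLp_fst (h.memLp_avg_z t))

theorem avgErr_le (hf : ∀ i, Differentiable ℝ (f i)) (t : ℕ) :
    h.avgErr t ≤ 2 * L ^ 2 * h.meanConsZ t + 2 * h.meanErr t := by
  have h1 := integral_le_two (integrable_norm_sq (h.memLp_avg_err hF t))
    (integrable_consensusErr (h.memLp_path t).1) (integrable_sum_norm_sq (h.memLp_err t))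
    (h.norm_avg_sub_gradient_sq_le hf t)
  rw [integral_sum_norm_sq (h.memLp_err t)] at h1
  refine h1.trans (le_of_eq ?_)
  simp only [meanConsZ, meanErr]
  ring

theorem dirY_le (t : ℕ) : h.dirY t ≤ 2 * L ^ 2 * h.gap t + 2 * h.avgErr t :=
  integral_le_two (integrable_norm_sq (memLp_snd (h.memLp_avg_v t))) (h.integrable_gapSq hF t)
    (integrable_norm_sq (h.memLp_avg_err hF t)) fun _ => hF.norm_snd_sq_le _ _

theorem value_succ_le (hK : L * (1 + (L / μ) ^ 2) * p.ηx ≤ 1 / 4) (t : ℕ) :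
    p.ηx / 2 * h.gradSq t + p.ηx / 4 * h.dirX t
      ≤ (h.value t - h.value (t + 1)) + p.ηx * (L ^ 2 * h.gap t + h.avgErr t) := by
  have h1 := integral_le_five (k := 1) (l := -(p.ηx / 2)) (n := -(p.ηx / 4))
    (k' := p.ηx * L ^ 2) (l' := p.ηx)
    (h.integrable_value hF (t + 1)) (h.integrable_value hF t) (h.integrable_gradSq hF t)
    (integrable_norm_sq (memLp_fst (h.memLp_avg_v t))) (h.integrable_gapSq hF t)
    (integrable_norm_sq (h.memLp_avg_err hF t)) fun ω => by
      have h2 := hF.max_move_le h.ηx_nonneg hK (avg (h.path t ω).z) (avg (h.path t ω).v)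
      rw [h.avg_z_succ]
      linarith
  simp only [value, gradSq, dirX, gap, avgErr]
  linarith

theorem gap_succ_le (hy : 0 < p.ηy) (h1 : p.ηy * L ^ 2 ≤ μ) (h2 : p.ηy * μ ≤ 1) (t : ℕ) :
    h.gap (t + 1) ≤ (1 - p.ηy * μ / 2) * h.gap t + 6 / (p.ηy * μ)
      * (p.ηy ^ 2 * h.avgErr t + (L / μ) ^ 2 * p.ηx ^ 2 * h.dirX t) := by
  have h3 := integral_le_three (k := 1 - p.ηy * μ / 2) (l := 6 / (p.ηy * μ) * p.ηy ^ 2)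
    (n := 6 / (p.ηy * μ) * ((L / μ) ^ 2 * p.ηx ^ 2))
    (h.integrable_gapSq hF (t + 1)) (h.integrable_gapSq hF t)
    (integrable_norm_sq (h.memLp_avg_err hF t))
    (integrable_norm_sq (memLp_fst (h.memLp_avg_v t))) fun ω => by
      have h4 := hF.gapSq_move_le hy h1 h2 (avg (h.path t ω).z) (avg (h.path t ω).v)
      rw [h.avg_z_succ]
      linarith
  simp only [dirX, gap, avgErr]
  linarith

theorem sum_gradSq_le (hf : ∀ i, Differentiable ℝ (f i)) (hm : 0 < m) (hηx : 0 < p.ηx)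
    (k0 : p.ηy * L ≤ 1 / (64 * (L / μ)))
    (k1 : p.ηy ^ 2 * L ^ 2 ≤ (1 - mixingRate W) ^ 4 / 5120)
    (k2 : p.ηy ^ 2 ≤ (1 - mixingRate W) ^ 4 / 5120)
    (k3 : (L / μ) ^ 2 * (p.ηy ^ 2 * L ^ 2) ≤ 1 / 5120) (k4 : 64 * (L / μ) ^ 2 * p.ηx ≤ p.ηy)
    (T : ℕ) :
    p.ηx / 50 * ∑ t ∈ Finset.range T, h.gradSq t ≤ (h.value 0 - h.value T)
      + p.ηx * (18 * L * (L / μ) / p.ηy * h.gap 0 + 9772 * L ^ 2 * (L / μ) ^ 2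
        / (1 - mixingRate W) * (h.meanConsZ 0 + h.meanConsDir 0)
        + 323 * (L / μ) ^ 2 * (T * (σ ^ 2 / p.S₁))) := by
  have hL := hF.L_pos
  have hμ := hF.μ_pos
  have hκ : 1 ≤ L / μ := hF.one_le_cond hm
  have hy : 0 < p.ηy := hηx.trans_le h.ηx_le
  have hg : 0 < 1 - mixingRate W := by linarith [h.rate_lt_one]
  have hg1 : 1 - mixingRate W ≤ 1 := by linarith [mixingRate_nonneg W]
  have eκ : L / (L / μ) = μ := by field_simp
  have hyLκ : p.ηy * L * (L / μ) ≤ 1 / 64 := by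
    rw [le_div_iff₀ (by positivity)] at k0
    linarith
  have c1 : p.ηy * L ^ 2 ≤ μ := by
    have : p.ηy * L ^ 2 = p.ηy * L * (L / μ) * μ := by field_simp
    rw [this]
    nlinarith
  have hyL : p.ηy * L ≤ 1 / 64 :=
    (le_mul_of_one_le_right (by positivity) hκ).trans hyLκ
  have c2 : p.ηy * μ ≤ 1 := by
    have : μ ≤ L := (one_le_div hμ).1 hκ
    have := mul_le_mul_of_nonneg_left this hy.le
    linarith
  -- 1 + κ² ≤ 2κ², and 64 κ² ηx ≤ ηy reduces the claim to the bound on ηy L.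
  have c3 : L * (1 + (L / μ) ^ 2) * p.ηx ≤ 1 / 4 := by
    have h1 : 1 ≤ (L / μ) ^ 2 := one_le_pow₀ hκ
    have h2 : L * (1 + (L / μ) ^ 2) * p.ηx ≤ L * (2 * (L / μ) ^ 2) * p.ηx := by
      gcongr; linarith
    have h3 := mul_le_mul_of_nonneg_left k4 hL.le
    linarith
  have hX : ∀ t, 0 ≤ h.dirX t := fun t => integral_nonneg fun _ => sq_nonneg _
  have hgap : ∀ t, 0 ≤ h.gap t := fun t => integral_nonneg fun _ => sq_nonneg _
  have hG : ∀ t, 0 ≤ h.gradSq t := fun t => integral_nonneg fun _ => sq_nonneg _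
  have sB : ∑ t ∈ Finset.range T, h.avgErr t ≤ 2 * L ^ 2 * ∑ t ∈ Finset.range T, h.meanConsZ t
      + 2 * ∑ t ∈ Finset.range T, h.meanErr t := by
    rw [Finset.mul_sum, Finset.mul_sum, ← Finset.sum_add_distrib]
    exact Finset.sum_le_sum fun t _ => h.avgErr_le hF hf t
  refine sum_bound (X := ∑ t ∈ Finset.range T, h.dirX t) (Y := ∑ t ∈ Finset.range T, h.dirY t)
    (Cz := ∑ t ∈ Finset.range T, h.meanConsZ t) (Cd := ∑ t ∈ Finset.range T, h.meanConsDir t)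
    (D := ∑ t ∈ Finset.range T, h.meanDisp t) (Ev := ∑ t ∈ Finset.range T, h.meanErr t)
    (δ := ∑ t ∈ Finset.range T, h.gap t)
    hL hκ hg hg1 hηx hy k1 k2 k3 k4 (Finset.sum_nonneg fun t _ => hG t)
    (Finset.sum_nonneg fun t _ => hX t) (Finset.sum_nonneg fun t _ => h.meanDisp_nonneg t)
    (by positivity) (Finset.sum_nonneg fun t _ => hgap t) (hgap 0) (h.meanConsZ_nonneg 0)
    (h.meanConsDir_nonneg 0) (Finset.sum_nonneg fun t _ => h.meanConsZ_nonneg t)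
    (Finset.sum_nonneg fun t _ => h.meanErr_nonneg t) (h.sum_meanErr_le T) ?_ ?_ ?_ ?_ ?_ ?_
  · have h1 := Finset.sum_le_sum fun t (_ : t ∈ Finset.range T) => h.meanDisp_le t
    refine h1.trans (le_of_eq ?_)
    simp only [Finset.mul_sum, ← Finset.sum_add_distrib]
    rfl
  · have h1 := sum_le_of_geometric h.meanConsZ_nonneg h.meanConsZ_succ_le T
    rwa [← Finset.mul_sum] at h1
  · have h1 := sum_le_of_geometric h.meanConsDir_nonneg h.meanConsDir_succ_le T
    rw [← Finset.mul_sum, Finset.sum_add_distrib, Finset.sum_add_distrib, ← Finset.mul_sum,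
      ← Finset.mul_sum, Finset.sum_const, Finset.card_range, nsmul_eq_mul] at h1
    exact h1
  · have h1 := Finset.sum_le_sum fun t (_ : t ∈ Finset.range T) => h.value_succ_le hF c3 t
    simp only [Finset.sum_add_distrib, ← Finset.mul_sum, Finset.sum_range_sub'] at h1
    have h2 := mul_le_mul_of_nonneg_left sB hηx.le
    linarith
  · rw [eκ]
    have h1 := sum_le_of_geometric hgap (h.gap_succ_le hF hy c1 c2) T
    simp only [Finset.sum_add_distrib, ← Finset.mul_sum] at h1
    have h2 : 6 / (p.ηy * μ) * (p.ηy ^ 2 * ∑ t ∈ Finset.range T, h.avgErr t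
        + (L / μ) ^ 2 * p.ηx ^ 2 * ∑ t ∈ Finset.range T, h.dirX t)
      ≤ 6 / (p.ηy * μ) * (p.ηy ^ 2 * (2 * L ^ 2 * ∑ t ∈ Finset.range T, h.meanConsZ t
      + 2 * ∑ t ∈ Finset.range T, h.meanErr t)
        + (L / μ) ^ 2 * p.ηx ^ 2 * ∑ t ∈ Finset.range T, h.dirX t) := by gcongr
    linarith
  · have h1 := Finset.sum_le_sum fun t (_ : t ∈ Finset.range T) => h.dirY_le hF t
    simp only [Finset.sum_add_distrib, ← Finset.mul_sum] at h1
    linarith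

end Setting

end

end DGDA

/-! ### The theorem: step-size conditions and translation of the summed bound -/

theorem mainTheorem2
    {M d m : ℕ} (hM : 0 < M) (hm : 0 < m)
    {Ξ Ω : Type*} [MeasurableSpace Ξ] [MeasurableSpace Ω]
    (Pr : Measure Ω) [IsProbabilityMeasure Pr]
    (P : Fin M → Measure Ξ) [∀ i, IsProbabilityMeasure (P i)]
    -- the problem: differentiable local functions, strongly concave in `y`
    (f : Fin M → DGDA.Pt d m → ℝ) (L μ σ : ℝ) (hL : 0 < L) (hμ : 0 < μ) (hσ : 0 ≤ σ)
    (hdiff : ∀ i, Differentiable ℝ (f i))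
    (hconc : ∀ i x, StrongConcaveOn Set.univ μ fun y => f i (DGDA.pt x y))
    (hbdd : BddBelow (Set.range (DGDA.primal f)))
    -- the oracles and the samples
    (g : Fin M → DGDA.Pt d m → Ξ → DGDA.Pt d m) (hg : DGDA.IsOracle f g P σ L)
    (ξ : ℕ → Ω → Fin M → ℕ → Ξ) (hξ : DGDA.IsSampling P Pr ξ)
    -- the network
    (edge : Fin M → Fin M → Prop) (W : Matrix (Fin M) (Fin M) ℝ) (hW : DGDA.IsMixing edge W)
    -- the parameters; the bound `hηy` follows from `hp` when `1 ≤ L`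
    (p : DGDA.Params) (hp : DGDA.ParamCondition p L μ (DGDA.mixingRate W))
    (hηy : p.ηy ≤ (1 - DGDA.mixingRate W) ^ 2 / (32 * √5))
    (hr : p.r ≤ 1)
    -- the initialisation: the tracking variables and the gradient estimators have equal averages
    (z₀ : Fin M → DGDA.Pt d m) (D₀ : (Fin M → ℕ → Ξ) → Fin M → DGDA.Pt d m)
    (hD₀_meas : Measurable D₀)
    (hD₀_sq : ∀ i, MemLp (fun ω => D₀ (ξ 0 ω) i) 2 Pr)
    (hD₀_avg : ∀ c, DGDA.avg (D₀ c) = DGDA.avg (DGDA.batchGrad g p.S₁ z₀ c))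
    -- the horizon
    (T N : ℕ) (hN : 1 ≤ N) (hT : T = N * p.q) :
    Differentiable ℝ (DGDA.primal f) ∧
    (∀ j, Integrable
      (fun ω => ‖gradient (DGDA.primal f) (DGDA.xbar p W g z₀ D₀ ξ j ω)‖ ^ 2) Pr) ∧
    (∀ j, Integrable (fun ω => DGDA.primal f (DGDA.xbar p W g z₀ D₀ ξ j ω)) Pr) ∧
    1 / (T : ℝ) * ∑ j ∈ Finset.range T,
        ∫ ω, ‖gradient (DGDA.primal f) (DGDA.xbar p W g z₀ D₀ ξ j ω)‖ ^ 2 ∂Pr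
      ≤ 1 / (T : ℝ) *
          (50 / p.ηx * ∫ ω, (DGDA.primal f (DGDA.xbar p W g z₀ D₀ ξ 0 ω)
              - DGDA.primal f (DGDA.xbar p W g z₀ D₀ ξ T ω)) ∂Pr
            + 900 * L * (L / μ) / p.ηy
              * ‖DGDA.bestResponse f (DGDA.avg z₀).fst - (DGDA.avg z₀).snd‖ ^ 2
            + 50 * 9772 * L ^ 2 * (L / μ) ^ 2 / ((1 - DGDA.mixingRate W) * M)
              * (DGDA.consensusErr z₀ + ∫ ω, DGDA.consensusErr (D₀ (ξ 0 ω)) ∂Pr))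
        + 50 * 323 * (L / μ) ^ 2 * σ ^ 2 / p.S₁ := by
  have hF : DGDA.IsSaddle (DGDA.mean f) L μ := DGDA.isSaddle_mean hM hL hμ hdiff hconc
    fun i z z' => hg.gradient_lipschitz hL.le i z z'
  have hκ : 1 ≤ L / μ := hF.one_le_cond hm
  have hκ2 : 1 ≤ (L / μ) ^ 2 := one_le_pow₀ hκ
  have hx := hp.ηx_pos
  have hy := hp.ηy_pos
  have hg0 : 0 < 1 - DGDA.mixingRate W := by linarith [hW.rate_lt_one]
  have h5 : (0 : ℝ) < √5 := by positivity
  have h5' : √5 ^ 2 = (5 : ℝ) := Real.sq_sqrt (by norm_num)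
  have k4 : 64 * (L / μ) ^ 2 * p.ηx ≤ p.ηy := by
    have h1 := ((hp.ηx_le.trans (min_le_right _ _)).trans (min_le_right _ _)).trans
      (min_le_right _ _)
    rw [one_div_mul_eq_div, le_div_iff₀ (by positivity)] at h1
    linarith
  have hxy : p.ηx ≤ p.ηy := by nlinarith
  -- (32√5)² = 5120.
  have sq_bound : ∀ a b : ℝ, 0 ≤ a → a * (32 * √5) ≤ b → a ^ 2 ≤ b ^ 2 / 5120 := by
    intro a b ha hab
    have h1 := pow_le_pow_left₀ (by positivity) hab 2
    rw [mul_pow, mul_pow, h5'] at h1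
    linarith
  have hyL : ∀ c, min ((1 - DGDA.mixingRate W) ^ 2)
      (min (1 / (L / μ)) ((1 - DGDA.mixingRate W) / √(L / μ))) ≤ c →
      p.ηy * L * (32 * √5) ≤ c := by
    intro c hc
    have h1 := hp.ηy_le
    rw [one_div_mul_eq_div, le_div_iff₀ (by positivity)] at h1
    linarith
  have k1 : p.ηy ^ 2 * L ^ 2 ≤ (1 - DGDA.mixingRate W) ^ 4 / 5120 := by
    have h1 := sq_bound (p.ηy * L) _ (by positivity) (hyL _ (min_le_left _ _))
    rw [← pow_mul, mul_pow] at h1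
    exact h1
  have k2 : p.ηy ^ 2 ≤ (1 - DGDA.mixingRate W) ^ 4 / 5120 := by
    rw [le_div_iff₀ (by positivity)] at hηy
    have h1 := sq_bound p.ηy _ hy.le hηy
    rw [← pow_mul] at h1
    exact h1
  have hyLκ := hyL _ ((min_le_right _ _).trans (min_le_left _ _))
  have k3 : (L / μ) ^ 2 * (p.ηy ^ 2 * L ^ 2) ≤ 1 / 5120 := by
    have h2 : L / μ * (p.ηy * L) * (32 * √5) ≤ 1 := by
      rw [le_div_iff₀ (by positivity)] at hyLκ
      linarith
    have h1 := sq_bound (L / μ * (p.ηy * L)) _ (by positivity) h2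
    rw [mul_pow, mul_pow] at h1
    linarith
  -- √5 ≥ 2, so 32√5 ≥ 64.
  have k0 : p.ηy * L ≤ 1 / (64 * (L / μ)) := by
    have h6 : (2 : ℝ) ≤ √5 := Real.le_sqrt_of_sq_le (by norm_num)
    rw [le_div_iff₀ (by positivity)] at hyLκ ⊢
    have h7 : 0 ≤ p.ηy * L * (L / μ) := by positivity
    nlinarith
  have h : DGDA.Setting Pr P f L σ g ξ W p z₀ D₀ :=
    ⟨hM, hL, hg, hξ, hW.row_sum, hW.col_sum, hW.rate_lt_one, hx.le, hxy, hp.S₁_pos, hp.q_pos,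
      hp.q_le_S₂, hD₀_meas, hD₀_sq, hD₀_avg⟩
  have ePhi : DGDA.primal f
      = fun x => DGDA.mean f (DGDA.pt x (DGDA.argmax (DGDA.mean f) x)) :=
    funext fun x => hF.iSup_eq x
  have eGrad : ∀ x, gradient (DGDA.primal f) x
      = (gradient (DGDA.mean f) (DGDA.pt x (DGDA.argmax (DGDA.mean f) x))).fst := fun x => by
    rw [ePhi]; exact (hF.hasGradientAt_max x).gradient
  have iVal := h.integrable_value hF
  refine ⟨?_, fun j => ?_, fun j => ?_, ?_⟩
  · rw [ePhi]
    exact fun x => (hF.hasGradientAt_max x).differentiableAt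
  · simp only [eGrad]
    exact h.integrable_gradSq hF j
  · rw [ePhi]
    exact iVal j
  have key := h.sum_gradSq_le hF hdiff hm hx k0 k1 k2 k3 k4 T
  have hT0 : (0 : ℝ) < T := by
    have := Nat.mul_pos hN hp.q_pos
    rw [hT]; exact_mod_cast this
  have hM0 : (0 : ℝ) < M := by exact_mod_cast hM
  have hS0 : (0 : ℝ) < p.S₁ := by exact_mod_cast hp.S₁_pos
  have e1 : ∑ j ∈ Finset.range T,
      ∫ ω, ‖gradient (DGDA.primal f) (DGDA.xbar p W g z₀ D₀ ξ j ω)‖ ^ 2 ∂Pr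
      = ∑ t ∈ Finset.range T, h.gradSq t := by
    simp only [eGrad]; rfl
  have e2 : ∫ ω, (DGDA.primal f (DGDA.xbar p W g z₀ D₀ ξ 0 ω)
      - DGDA.primal f (DGDA.xbar p W g z₀ D₀ ξ T ω)) ∂Pr = h.value 0 - h.value T := by
    rw [ePhi]
    exact integral_sub (iVal 0) (iVal T)
  have e3 : ‖DGDA.bestResponse f (DGDA.avg z₀).fst - (DGDA.avg z₀).snd‖ ^ 2 = h.gap 0 := by
    have : h.gap 0 = ∫ _ : Ω, DGDA.gapSq (DGDA.mean f) (DGDA.avg z₀) ∂Pr := rfl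
    rw [this, integral_const, probReal_univ, one_smul]
    rfl
  have e4 : h.meanConsZ 0 = 1 / (M : ℝ) * DGDA.consensusErr z₀ := by
    have : h.meanConsZ 0 = 1 / (M : ℝ) * ∫ _ : Ω, DGDA.consensusErr z₀ ∂Pr := rfl
    rw [this, integral_const, probReal_univ, one_smul]
  have e5 : h.meanConsDir 0 = 1 / (M : ℝ) * ∫ ω, DGDA.consensusErr (D₀ (ξ 0 ω)) ∂Pr := rfl
  rw [e1, e2, e3]
  rw [e4, e5] at key
  -- Dividing out the coefficient ηx / 50 produces the factor 50 of the final constants, in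
  -- particular 900 = 50 · 18.
  have k5 := mul_le_mul_of_nonneg_left key (by positivity : 0 ≤ 1 / (T : ℝ) * (50 / p.ηx))
  refine (le_of_eq ?_).trans (k5.trans (le_of_eq ?_))
  · field_simp
  · field_simp
    ring
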